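/- Let $\mathbb K$ be a field of characteristic $0$, let $n\ge 2$, and let $R=\mathbb K[x_0,\dots,x_n]$. For a finite nonempty set of points $\Gamma\subset\mathbb P^n_{\mathbb K}$ with homogeneous ideal $I(\Gamma)\subset R$, let $\mathrm{hyp}(\Gamma)$ be the maximal number of points of $\Gamma$ lying in a hyperplane and let $d(\Gamma)=|\Gamma|-\mathrm{hyp}(\Gamma)$. If $$0\to F_n=\bigoplus_i R(-a_i)\to\cdots\to F_1\to R\to R/I(\Gamma)\to 0$$ is the graded minimal free resolution, let $A_n=A_n(\Gamma)=\min_i\{a_i-n\}$. A set $\Gamma_1$ of $\alpha$ points in a hyperplane $H\cong\mathbb P^{n-1}$ of $\mathbb P^n$ is called generic in $H$ if its Hilbert function is maximal: $\dim_{\mathbb K}(R/I(\Gamma_1))_i=\min\{\binom{i+n-1}{n-1},\alpha\}$ for all $i\ge 0$. Let $H\subset\mathbb P^n$ be a hyperplane, $L\subset\mathbb P^n$ a line not contained in $H$, and $\Gamma_2\subset L\setminus H$ a set of $\beta\ge 1$ distinct points; let $\alpha\ge\beta+n-2$. For every set $\Gamma_1$ of $\alpha$ points of $H$ that is generic in $H$,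 put $\Gamma=\Gamma_1\cup\Gamma_2$. Then: 1. If $\alpha<\binom{\beta+n-3}{n-1}$ and $\mathrm{hyp}(\Gamma)=\alpha$, then $d(\Gamma)>A_n$. 2. If $\alpha\ge\binom{\beta+n}{n-1}$, then $d(\Gamma)=A_n$ (so the general lower bound $d(\Gamma)\ge A_n$ for non-degenerate sets of points is sharp). Moreover, if $\alpha\ge n$, then the conditions "$\Gamma_1$ consists of $\alpha$ points and is generic in $H$, and $\mathrm{hyp}(\Gamma_1\cup\Gamma_2)=\alpha$" hold for general points of $H$: they hold for all $\alpha$-tuples of points of $H$ in some nonempty Zariski open set. In particular, 1. applies to general points of $H$. -/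

import Mathlib

open scoped LinearAlgebra.Projectivization

noncomputable section

namespace PointSets

variable {K : Type*} [Field K] {n : ℕ}

/-- The homogeneous ideal in `K[x₀, …, xₙ]` of a set of points of `ℙⁿ`, generated by the
homogeneous polynomials that vanish at all the points. -/
def idealOf (Γ : Set (ℙ K (Fin (n + 1) → K))) : Ideal (MvPolynomial (Fin (n + 1)) K) :=
  Ideal.span {f | (∃ k, f.IsHomogeneous k) ∧ ∀ P ∈ Γ, MvPolynomial.eval P.rep f = 0}

/-- The Hilbert function `HF(R/I, i) = dim_K (R/I)_i`, where `(R/I)_i` is the image in `R/I` of the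
space of forms of degree `i`. -/
def hilbertFunction (I : Ideal (MvPolynomial (Fin (n + 1)) K)) (i : ℕ) : ℕ :=
  Module.finrank K
    ((MvPolynomial.homogeneousSubmodule (Fin (n + 1)) K i).map
      (Ideal.Quotient.mkₐ K I).toLinearMap)

/-- `Γ`, a finite set of points in an `m`-dimensional linear subspace of `ℙⁿ`, is generic in that
subspace: its Hilbert function is the largest possible one. (If the subspace has coordinate ring
`S` and `Γ` has ideal `J` in `S`, then `S/J = R/I(Γ)`, so the Hilbert function can be computed
in `R`.) -/
def IsGenericSet (m : ℕ) (Γ : Set (ℙ K (Fin (n + 1) → K))) : Prop :=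
  ∀ i : ℕ, hilbertFunction (idealOf Γ) i = min ((i + m).choose m) Γ.ncard

/-- The maximal number of points of `Γ` in a hyperplane of `ℙⁿ`. Hyperplanes of `ℙⁿ` are linear
subspaces of dimension `n` of `Kⁿ⁺¹`. -/
def hyp (Γ : Set (ℙ K (Fin (n + 1) → K))) : ℕ :=
  sSup {k | ∃ H : Submodule K (Fin (n + 1) → K), Module.finrank K H = n ∧
    k = {P | P ∈ Γ ∧ P.submodule ≤ H}.ncard}

/-- The minimum distance `d(Γ) = |Γ| - hyp(Γ)`. -/
def minDist (Γ : Set (ℙ K (Fin (n + 1) → K))) : ℕ := Γ.ncard - hyp Γ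

/-- A graded minimal free resolution `⋯ → F₂ → F₁ → F₀ = R → R/I → 0` of `R/I`, where
`R = K[x₀, …, xₙ]`, `Fᵢ = ⨁ⱼ R(-shift i j)` and `Fᵢ₊₁ → Fᵢ` is given by the matrix `d i`. -/
structure MinimalGradedFreeResolution (I : Ideal (MvPolynomial (Fin (n + 1)) K)) where
  rank : ℕ → ℕ
  shift : (i : ℕ) → Fin (rank i) → ℤ
  d : (i : ℕ) → Matrix (Fin (rank i)) (Fin (rank (i + 1))) (MvPolynomial (Fin (n + 1)) K)
  /-- the differentials are homogeneous of degree `0` -/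
  homogeneous : ∀ i p q, d i p q ≠ 0 →
    ∃ k : ℕ, (d i p q).IsHomogeneous k ∧ shift i p + k = shift (i + 1) q
  /-- `F₀ = R` -/
  rank_zero : rank 0 = 1
  shift_zero : ∀ p, shift 0 p = 0
  /-- the image of `F₁ → F₀ = R` is `I` -/
  range_zero : ∀ v : Fin (rank 0) → MvPolynomial (Fin (n + 1)) K,
    v ∈ LinearMap.range (d 0).mulVecLin ↔ ∀ p, v p ∈ I
  exact : ∀ i, LinearMap.range (d (i + 1)).mulVecLin = LinearMap.ker (d i).mulVecLin
  /-- minimality: all entries of the matrices lie in the ideal `(x₀, …, xₙ)` -/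
  minimal : ∀ i p q, MvPolynomial.constantCoeff (d i p q) = 0

/-- The socle degrees `a - n` of `R/I(Γ)`, where `R(-a)` runs over the direct summands of the module
`Fₙ` in the graded minimal free resolution of `R/I(Γ)`. (The resolution is unique up to
isomorphism, and `Fₙ` is its last nonzero module when `Γ` is finite and nonempty.) -/
def socleDegrees (Γ : Set (ℙ K (Fin (n + 1) → K))) : Set ℤ :=
  {c | ∃ (F : MinimalGradedFreeResolution (idealOf Γ)) (j : Fin (F.rank n)),
    c = F.shift n j - n}

/-- The property `p` holds for a general set of `α` points of the linear subspace `H` of `ℙⁿ`: there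
is a nonempty Zariski open set of `α`-tuples, given by `F ≠ 0` for a polynomial `F` in the
coordinates of the points, such that `p` holds for the set of points of every tuple in it. -/
def ForGeneralPoints (H : Submodule K (Fin (n + 1) → K)) (α : ℕ)
    (p : Set (ℙ K (Fin (n + 1) → K)) → Prop) : Prop :=
  ∃ F : MvPolynomial (Fin α × Fin (n + 1)) K,
    (∃ w : Fin α → Fin (n + 1) → K, (∀ j, w j ∈ H ∧ w j ≠ 0) ∧
      MvPolynomial.eval (fun x => w x.1 x.2) F ≠ 0) ∧
    ∀ (w : Fin α → Fin (n + 1) → K) (_ : ∀ j, w j ∈ H) (h0 : ∀ j, w j ≠ 0),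
      MvPolynomial.eval (fun x => w x.1 x.2) F ≠ 0 →
        p (Set.range fun j => Projectivization.mk K (w j) (h0 j))

end PointSets

end

/-! Write I = I(Γ). If φ₀ is a linear form vanishing at no point of Γ, it is a nonzerodivisor on
R/I, and the shifts of Fₙ lowered by n are the degrees of the socle elements of R/(I + (φ₀)).
Indeed, dividing by the members of a regular sequence of linear forms one at a time gives connecting
maps that match this socle with Fₙ ⊗ K (`mem_socleDegrees_iff`). So Aₙ is the least socle degree,
and everything is computed modulo φ₀.

Take coordinates in which φ₁ = 0 is H and T = (φᵢ : i ≥ 2) is the ideal of L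
(`exists_adapted_basis`). A form of degree less than β vanishing on Γ₂ lies in T
(`mem_formIdeal_lineIdx`).

Many points: every form of degree at most β vanishing on Γ₁ is divisible by φ₁, hence I and φ₁T
agree in degrees at most β. Modulo φ₀ this leaves no socle below degree β (`mem_sup_of_socle`),
whereas φ₁^β is a socle element (`mul_pow_mem_sup`, `pow_notMem_sup`). The same divisibility gives
hyp(Γ) = α (`hyp_le_ncard`), so d(Γ) = β = Aₙ.

Few points: Γ₁ imposes independent conditions on forms of degree β - 2. The image of T modulo (I ∩
T) + (φ₀) is nonzero in degree 1, because Γ₁ has a point off L (`exists_linForm_notMem`), and zero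
in degree β, by interpolation (`mem_sup_of_hilbertFunction_eq`). Hence in some degree c < β it is
nonzero while it vanishes in degree c + 1; this gives a socle element modulo (I ∩ T) + (φ₀). It
survives modulo I + (φ₀) because I is contained in T in degrees below β. Thus Aₙ < β = d(Γ).

General points: genericity and the bound on hyp follow from the nonvanishing of finitely many
evaluation determinants, none of which is identically zero on tuples of vectors of H
(`forGeneralPoints_generic`). -/

open scoped LinearAlgebra.Projectivization

noncomputable section

namespace PointSets

open MvPolynomial

/-! ### Homogeneous components of integer degree. -/

section IntegerDegrees

variable {σ K : Type*} [Field K]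

/-- The homogeneous component of integer degree `z` (zero if `z < 0`). -/
def intComponent (z : ℤ) : MvPolynomial σ K →ₗ[K] MvPolynomial σ K :=
  if 0 ≤ z then homogeneousComponent z.toNat else 0

lemma intComponent_natCast (k : ℕ) (f : MvPolynomial σ K) :
    intComponent (k : ℤ) f = homogeneousComponent k f := by
  simp [intComponent]

lemma intComponent_of_neg {z : ℤ} (hz : z < 0) (f : MvPolynomial σ K) :
    intComponent z f = 0 := by
  simp [intComponent, not_le.2 hz]

lemma intComponent_of_isHomogeneous {k : ℕ} {f : MvPolynomial σ K} (hf : f.IsHomogeneous k)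
    (z : ℤ) : intComponent z f = if z = k then f else 0 := by
  rcases lt_or_ge z 0 with hz | hz
  · rw [intComponent_of_neg hz, if_neg (by omega)]
  · lift z to ℕ using hz
    rw [intComponent_natCast, homogeneousComponent_of_mem hf]
    simp [eq_comm]

lemma coeff_intComponent (z : ℤ) (f : MvPolynomial σ K) (d : σ →₀ ℕ) :
    coeff d (intComponent z f) = if (d.degree : ℤ) = z then coeff d f else 0 := by
  rcases lt_or_ge z 0 with hz | hz
  · rw [intComponent_of_neg hz, if_neg (by omega), coeff_zero]
  · lift z to ℕ using hz
    rw [intComponent_natCast, coeff_homogeneousComponent]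
    simp

/-- Integer degrees make the formula uniform: for z < k both sides vanish. -/
lemma intComponent_mul_left {k : ℕ} {g : MvPolynomial σ K} (hg : g.IsHomogeneous k) (z : ℤ)
    (f : MvPolynomial σ K) : intComponent z (g * f) = g * intComponent (z - k) f := by
  have key : ∀ (m : ℕ) (f : MvPolynomial σ K), f.IsHomogeneous m →
      intComponent z (g * f) = g * intComponent (z - k) f := by
    intro m f hf
    rw [intComponent_of_isHomogeneous (hg.mul hf), intComponent_of_isHomogeneous hf]
    by_cases h : z = ((k + m : ℕ) : ℤ)
    · rw [if_pos h, if_pos (by push_cast at h; omega)]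
    · rw [if_neg h, if_neg (by push_cast at h; omega), mul_zero]
  rw [← sum_homogeneousComponent f]
  simp only [Finset.mul_sum, map_sum]
  exact Finset.sum_congr rfl fun i _ => key i _ (homogeneousComponent_isHomogeneous i f)

lemma isHomogeneous_intComponent (z : ℤ) (f : MvPolynomial σ K) :
    (intComponent z f).IsHomogeneous z.toNat := by
  unfold intComponent
  split_ifs
  · exact homogeneousComponent_isHomogeneous _ _
  · exact isHomogeneous_zero _ _ _

lemma intComponent_idem (z : ℤ) (f : MvPolynomial σ K) :
    intComponent z (intComponent z f) = intComponent z f := by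
  ext d
  simp only [coeff_intComponent]
  split_ifs <;> rfl

lemma intComponent_zero (f : MvPolynomial σ K) : intComponent 0 f = C (constantCoeff f) := by
  have := intComponent_natCast 0 f
  rw [Nat.cast_zero] at this
  rw [this, homogeneousComponent_zero, constantCoeff_eq]

/-- An ideal containing the homogeneous components of its elements. -/
def IsGradedIdeal (I : Ideal (MvPolynomial σ K)) : Prop :=
  ∀ f ∈ I, ∀ z, intComponent z f ∈ I

lemma isGradedIdeal_span {S : Set (MvPolynomial σ K)} (hS : ∀ f ∈ S, ∃ k, f.IsHomogeneous k) :
    IsGradedIdeal (Ideal.span S) := by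
  intro f hf
  induction hf using Submodule.span_induction with
  | mem x hx =>
    intro z
    obtain ⟨k, hk⟩ := hS x hx
    rw [intComponent_of_isHomogeneous hk]
    split_ifs
    · exact Ideal.subset_span hx
    · exact zero_mem _
  | zero => simp
  | add x y _ _ hx hy => intro z; rw [map_add]; exact add_mem (hx z) (hy z)
  | smul a x _ hx =>
    intro z
    rw [smul_eq_mul, ← sum_homogeneousComponent a, Finset.sum_mul, map_sum]
    refine sum_mem fun i _ => ?_
    rw [intComponent_mul_left (homogeneousComponent_isHomogeneous i a)]
    exact Ideal.mul_mem_left _ _ (hx _)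

lemma mem_of_forall_homogeneousComponent_mem {I : Ideal (MvPolynomial σ K)}
    {f : MvPolynomial σ K} (h : ∀ i, homogeneousComponent i f ∈ I) : f ∈ I := by
  rw [← sum_homogeneousComponent f]
  exact sum_mem fun i _ => h i

/-- The homogeneous component of degree `a` of a vector of polynomials, where the `p`-th basis
vector has degree `s p`. -/
def vecComponent {r : ℕ} (s : Fin r → ℤ) (a : ℤ) :
    (Fin r → MvPolynomial σ K) →ₗ[K] (Fin r → MvPolynomial σ K) :=
  LinearMap.pi fun p => intComponent (a - s p) ∘ₗ LinearMap.proj p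

@[simp]
lemma vecComponent_apply {r : ℕ} (s : Fin r → ℤ) (a : ℤ) (v : Fin r → MvPolynomial σ K)
    (p : Fin r) : vecComponent s a v p = intComponent (a - s p) (v p) := rfl

lemma vecComponent_idem {r : ℕ} (s : Fin r → ℤ) (a : ℤ) (v : Fin r → MvPolynomial σ K) :
    vecComponent s a (vecComponent s a v) = vecComponent s a v := by
  ext1 p
  simp [intComponent_idem]

lemma vecComponent_smul {r : ℕ} (s : Fin r → ℤ) {k : ℕ} {y : MvPolynomial σ K}
    (hy : y.IsHomogeneous k) (a : ℤ) (v : Fin r → MvPolynomial σ K) :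
    vecComponent s (a + k) (y • v) = y • vecComponent s a v := by
  ext1 p
  simp only [vecComponent_apply, Pi.smul_apply, smul_eq_mul, intComponent_mul_left hy]
  congr 3
  ring

/-- A matrix of forms which defines a map of degree `0` of graded free modules. -/
def IsGradedMatrix {r r' : ℕ} (s : Fin r → ℤ) (t : Fin r' → ℤ)
    (D : Matrix (Fin r) (Fin r') (MvPolynomial σ K)) : Prop :=
  ∀ p q, D p q ≠ 0 → ∃ k : ℕ, (D p q).IsHomogeneous k ∧ s p + k = t q

lemma IsGradedMatrix.vecComponent_mulVec {r r' : ℕ} {s : Fin r → ℤ} {t : Fin r' → ℤ}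
    {D : Matrix (Fin r) (Fin r') (MvPolynomial σ K)} (hD : IsGradedMatrix s t D) (a : ℤ)
    (v : Fin r' → MvPolynomial σ K) :
    vecComponent s a (D.mulVec v) = D.mulVec (vecComponent t a v) := by
  ext1 p
  simp only [vecComponent_apply, Matrix.mulVec, dotProduct, map_sum]
  refine Finset.sum_congr rfl fun q _ => ?_
  by_cases h : D p q = 0
  · simp [h]
  · obtain ⟨k, hk, hst⟩ := hD p q h
    rw [intComponent_mul_left hk, show a - s p - k = a - t q by omega]

lemma exists_sum_vecComponent {r : ℕ} (s : Fin r → ℤ) (v : Fin r → MvPolynomial σ K) :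
    ∃ A : Finset ℤ, v = ∑ a ∈ A, vecComponent s a v := by
  classical
  refine ⟨Finset.univ.biUnion fun p => (v p).support.image fun m => (m.degree : ℤ) + s p, ?_⟩
  ext p m
  rw [Finset.sum_apply, coeff_sum]
  simp only [vecComponent_apply, coeff_intComponent]
  by_cases hm : coeff m (v p) = 0
  · simp [hm]
  · rw [Finset.sum_eq_single ((m.degree : ℤ) + s p)]
    · simp
    · intro b _ hb
      rw [if_neg (by omega)]
    · intro h
      exact absurd (Finset.mem_biUnion.2 ⟨p, Finset.mem_univ _,
        Finset.mem_image.2 ⟨m, mem_support_iff.2 hm, rfl⟩⟩) h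

end IntegerDegrees

/-! ### Homogeneous ideals of point sets. -/

section IdealOf

variable {K : Type*} [Field K] {n : ℕ}

lemma eval_rep_eq_zero_of_mem_idealOf {Γ : Set (ℙ K (Fin (n + 1) → K))}
    {f : MvPolynomial (Fin (n + 1)) K} (hf : f ∈ idealOf Γ) :
    ∀ P ∈ Γ, eval P.rep f = 0 := by
  intro P hP
  have : idealOf Γ ≤ RingHom.ker (eval P.rep) :=
    Ideal.span_le.2 fun g hg => hg.2 P hP
  exact this hf

lemma mem_idealOf_iff_of_isHomogeneous {Γ : Set (ℙ K (Fin (n + 1) → K))} {k : ℕ}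
    {f : MvPolynomial (Fin (n + 1)) K} (hk : f.IsHomogeneous k) :
    f ∈ idealOf Γ ↔ ∀ P ∈ Γ, eval P.rep f = 0 :=
  ⟨eval_rep_eq_zero_of_mem_idealOf, fun h => Ideal.subset_span ⟨⟨k, hk⟩, h⟩⟩

lemma isGradedIdeal_idealOf (Γ : Set (ℙ K (Fin (n + 1) → K))) : IsGradedIdeal (idealOf Γ) :=
  isGradedIdeal_span fun _ hf => hf.1

lemma constantCoeff_of_mem_idealOf {Γ : Set (ℙ K (Fin (n + 1) → K))} (hΓ : Γ.Nonempty)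
    {f : MvPolynomial (Fin (n + 1)) K} (hf : f ∈ idealOf Γ) : constantCoeff f = 0 := by
  obtain ⟨P, hP⟩ := hΓ
  have h := eval_rep_eq_zero_of_mem_idealOf (isGradedIdeal_idealOf Γ f hf 0) P hP
  simpa [intComponent_zero] using h

/-- A form of degree `k` vanishing at no point of `Γ` is a nonzerodivisor modulo `idealOf Γ`. -/
lemma mem_idealOf_of_mul_mem {Γ : Set (ℙ K (Fin (n + 1) → K))}
    {k : ℕ} {y f : MvPolynomial (Fin (n + 1)) K} (hy : y.IsHomogeneous k)
    (hyΓ : ∀ P ∈ Γ, eval P.rep y ≠ 0) (h : y * f ∈ idealOf Γ) : f ∈ idealOf Γ := by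
  refine mem_of_forall_homogeneousComponent_mem fun i => ?_
  rw [mem_idealOf_iff_of_isHomogeneous (homogeneousComponent_isHomogeneous i f)]
  intro P hP
  have h1 := isGradedIdeal_idealOf Γ _ h (i + k : ℕ)
  rw [intComponent_mul_left hy] at h1
  have h2 := eval_rep_eq_zero_of_mem_idealOf h1 P hP
  rw [map_mul, show ((i + k : ℕ) : ℤ) - k = i by push_cast; ring, intComponent_natCast] at h2
  exact (mul_eq_zero.1 h2).resolve_left (hyΓ P hP)

end IdealOf

/-! ### Existence of graded minimal free resolutions. -/

section Resolution

variable {σ K : Type*} [Field K]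

/-- A submodule of a graded free module containing the homogeneous components of its elements. -/
def IsGradedSubmodule {r : ℕ} (s : Fin r → ℤ)
    (N : Submodule (MvPolynomial σ K) (Fin r → MvPolynomial σ K)) : Prop :=
  ∀ v ∈ N, ∀ a, vecComponent s a v ∈ N

/-- `N` is generated by `k` homogeneous elements. -/
def HasHomogeneousGenerators {r : ℕ} (s : Fin r → ℤ)
    (N : Submodule (MvPolynomial σ K) (Fin r → MvPolynomial σ K)) (k : ℕ) : Prop :=
  ∃ (c : Fin k → Fin r → MvPolynomial σ K) (t : Fin k → ℤ),
    (∀ q, vecComponent s (t q) (c q) = c q) ∧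
      Submodule.span (MvPolynomial σ K) (Set.range c) = N

lemma IsGradedSubmodule.exists_hasHomogeneousGenerators [Finite σ] {r : ℕ} {s : Fin r → ℤ}
    {N : Submodule (MvPolynomial σ K) (Fin r → MvPolynomial σ K)}
    (hN : IsGradedSubmodule s N) : ∃ k, HasHomogeneousGenerators s N k := by
  have hX : Submodule.span (MvPolynomial σ K) {v | v ∈ N ∧ ∃ a, vecComponent s a v = v} = N := by
    refine le_antisymm (Submodule.span_le.2 fun v hv => hv.1) fun v hv => ?_
    obtain ⟨A, hA⟩ := exists_sum_vecComponent s v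
    rw [hA]
    exact sum_mem fun a _ => Submodule.subset_span ⟨hN v hv a, a, vecComponent_idem s a v⟩
  obtain ⟨S, hSX, hS⟩ := (Submodule.fg_span_iff_fg_span_finset_subset _).1
    (IsNoetherian.noetherian (Submodule.span (MvPolynomial σ K)
      {v | v ∈ N ∧ ∃ a, vecComponent s a v = v}))
  rw [hX] at hS
  choose t ht using fun q : Fin S.card => (hSX (S.equivFin.symm q).2).2
  refine ⟨S.card, fun q => S.equivFin.symm q, t, ht, ?_⟩
  rw [hS]
  congr 1
  ext v
  constructor
  · rintro ⟨q, rfl⟩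
    exact (S.equivFin.symm q).2
  · intro hv
    exact ⟨S.equivFin ⟨v, hv⟩, by simp⟩

/-- A relation with a nonzero scalar coefficient can be solved for the corresponding generator,
which is therefore redundant. -/
lemma HasHomogeneousGenerators.of_relation {r : ℕ} {s : Fin r → ℤ}
    {N : Submodule (MvPolynomial σ K) (Fin r → MvPolynomial σ K)} {k : ℕ}
    {c : Fin (k + 1) → Fin r → MvPolynomial σ K} {t : Fin (k + 1) → ℤ}
    (hc : ∀ q, vecComponent s (t q) (c q) = c q)
    (hN : Submodule.span (MvPolynomial σ K) (Set.range c) = N)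
    {v : Fin (k + 1) → MvPolynomial σ K} (hv : ∑ q, v q • c q = 0) {q : Fin (k + 1)} {x : K}
    (hx : x ≠ 0) (hq : v q = C x) : HasHomogeneousGenerators s N k := by
  refine ⟨fun i => c (q.succAbove i), fun i => t (q.succAbove i), fun i => hc _, ?_⟩
  rw [← hN]
  refine le_antisymm (Submodule.span_mono ?_) (Submodule.span_le.2 ?_)
  · rintro _ ⟨i, rfl⟩
    exact ⟨_, rfl⟩
  rintro _ ⟨i, rfl⟩
  rcases Fin.eq_self_or_eq_succAbove q i with h | ⟨j, h⟩
  · rw [Fin.sum_univ_succAbove _ q, hq] at hv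
    have h1 : c q = -((C x⁻¹ : MvPolynomial σ K) •
        ∑ i, v (q.succAbove i) • c (q.succAbove i)) := by
      rw [← smul_neg, ← eq_neg_of_add_eq_zero_left hv, smul_smul, ← C_mul, inv_mul_cancel₀ hx,
        C_1, one_smul]
    rw [h, h1]
    exact neg_mem (Submodule.smul_mem _ _ (sum_mem fun i _ =>
      Submodule.smul_mem _ _ (Submodule.subset_span ⟨i, rfl⟩)))
  · exact Submodule.subset_span ⟨j, by rw [h]⟩

/-- The columns of the matrix are homogeneous generators of least possible number. A relation with a
nonzero constant term would make one of them redundant. -/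
lemma IsGradedSubmodule.exists_minimal_presentation [Finite σ] {r : ℕ} {s : Fin r → ℤ}
    {N : Submodule (MvPolynomial σ K) (Fin r → MvPolynomial σ K)}
    (hN : IsGradedSubmodule s N) :
    ∃ (r' : ℕ) (t : Fin r' → ℤ) (D : Matrix (Fin r) (Fin r') (MvPolynomial σ K)),
      IsGradedMatrix s t D ∧ LinearMap.range D.mulVecLin = N ∧
        ∀ v, D.mulVec v = 0 → ∀ q, constantCoeff (v q) = 0 := by
  classical
  have hex := hN.exists_hasHomogeneousGenerators
  obtain ⟨c, t, hc, hspan⟩ := Nat.find_spec hex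
  have hD : IsGradedMatrix s t (Matrix.of fun p q => c q p) := by
    intro p q hpq
    have h1 : intComponent (t q - s p) (c q p) = c q p := congrFun (hc q) p
    rw [Matrix.of_apply] at hpq ⊢
    rcases lt_or_ge (t q - s p) 0 with hneg | hpos
    · exact absurd (by rw [← h1, intComponent_of_neg hneg]) hpq
    · exact ⟨(t q - s p).toNat, h1 ▸ isHomogeneous_intComponent _ _, by omega⟩
  have hsum : ∀ v, (Matrix.of fun p q => c q p).mulVec v = ∑ q, v q • c q := by
    intro v
    ext1 p
    simp [Matrix.mulVec, dotProduct, mul_comm]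
  refine ⟨_, t, Matrix.of fun p q => c q p, hD, ?_, ?_⟩
  · rw [Matrix.range_mulVecLin]
    exact hspan
  · intro v hv q
    by_contra hq
    -- In the component of the relation of degree `t q`, the coefficient at `q` is exactly the
    -- constant term of `v q`.
    have hv' : (Matrix.of fun p q => c q p).mulVec (vecComponent t (t q) v) = 0 := by
      rw [← hD.vecComponent_mulVec, hv, map_zero]
    rw [hsum] at hv'
    have hvq : vecComponent t (t q) v q = C (constantCoeff (v q)) := by
      rw [vecComponent_apply, sub_self, intComponent_zero]
    obtain ⟨k, hk⟩ : ∃ k, Nat.find hex = k + 1 := ⟨Nat.find hex - 1, by have := q.2; omega⟩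
    refine Nat.find_min hex (m := k) (by omega) ?_
    -- Generalising over the generators allows their number `Nat.find hex` to be rewritten as `k +
    -- 1`.
    clear hsum hD hv
    revert c t v q
    rw [hk]
    intro c t hc hspan v q hq hv' hvq
    exact HasHomogeneousGenerators.of_relation hc hspan hv' hq hvq

lemma IsGradedMatrix.isGradedSubmodule_ker {r r' : ℕ} {s : Fin r → ℤ} {t : Fin r' → ℤ}
    {D : Matrix (Fin r) (Fin r') (MvPolynomial σ K)} (hD : IsGradedMatrix s t D) :
    IsGradedSubmodule t (LinearMap.ker D.mulVecLin) := by
  intro v hv a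
  rw [LinearMap.mem_ker, Matrix.mulVecLin_apply] at hv ⊢
  rw [← hD.vecComponent_mulVec, hv, map_zero]

/-- A graded submodule of a graded free module. -/
structure GradedSubmoduleData (σ K : Type*) [Field K] where
  rank : ℕ
  shift : Fin rank → ℤ
  submodule : Submodule (MvPolynomial σ K) (Fin rank → MvPolynomial σ K)
  graded : IsGradedSubmodule shift submodule

namespace GradedSubmoduleData

variable [Finite σ] (N : GradedSubmoduleData σ K)

/-- A matrix whose columns are minimal homogeneous generators. -/
def genMatrix : Matrix (Fin N.rank) (Fin N.graded.exists_minimal_presentation.choose)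
    (MvPolynomial σ K) :=
  N.graded.exists_minimal_presentation.choose_spec.choose_spec.choose

/-- The degrees of minimal homogeneous generators. -/
def genShift : Fin N.graded.exists_minimal_presentation.choose → ℤ :=
  N.graded.exists_minimal_presentation.choose_spec.choose

lemma genMatrix_spec : IsGradedMatrix N.shift N.genShift N.genMatrix ∧
    LinearMap.range N.genMatrix.mulVecLin = N.submodule ∧
      ∀ v, N.genMatrix.mulVec v = 0 → ∀ q, constantCoeff (v q) = 0 :=
  N.graded.exists_minimal_presentation.choose_spec.choose_spec.choose_spec

/-- The module of relations between minimal homogeneous generators. -/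
def syzygies : GradedSubmoduleData σ K where
  rank := N.graded.exists_minimal_presentation.choose
  shift := N.genShift
  submodule := LinearMap.ker N.genMatrix.mulVecLin
  graded := N.genMatrix_spec.1.isGradedSubmodule_ker

/-- The iterated modules of relations. -/
def iterSyzygies : ℕ → GradedSubmoduleData σ K
  | 0 => N
  | i + 1 => (iterSyzygies i).syzygies

end GradedSubmoduleData

variable {n : ℕ}

/-- A graded ideal as a submodule of `R`. -/
def ofGradedIdeal {I : Ideal (MvPolynomial σ K)} (hI : IsGradedIdeal I) :
    GradedSubmoduleData σ K where
  rank := 1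
  shift := 0
  submodule := Submodule.pi Set.univ fun _ => I
  graded := fun _ hv _ p hp => hI _ (hv p hp) _

lemma constantCoeff_genMatrix [Finite σ] (N : GradedSubmoduleData σ K)
    (h : ∀ v ∈ N.submodule, ∀ p, constantCoeff (v p) = 0) (p) (q) :
    constantCoeff (N.genMatrix p q) = 0 := by
  classical
  have := h (N.genMatrix.mulVecLin (Pi.single q 1))
    (N.genMatrix_spec.2.1.le (LinearMap.mem_range_self _ _)) p
  simpa using this

/-- A proper graded ideal of `K[x₀, …, xₙ]` has a graded minimal free resolution. -/
lemma nonempty_minimalGradedFreeResolution {I : Ideal (MvPolynomial (Fin (n + 1)) K)}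
    (hI : IsGradedIdeal I) (h0 : ∀ f ∈ I, constantCoeff f = 0) :
    Nonempty (MinimalGradedFreeResolution I) := by
  let N : ℕ → GradedSubmoduleData (Fin (n + 1)) K := (ofGradedIdeal hI).iterSyzygies
  exact ⟨{
    rank := fun i => (N i).rank
    shift := fun i => (N i).shift
    d := fun i => (N i).genMatrix
    homogeneous := fun i => (N i).genMatrix_spec.1
    rank_zero := rfl
    shift_zero := fun _ => rfl
    range_zero := fun v => (SetLike.ext_iff.1 (N 0).genMatrix_spec.2.1 v).trans
      ⟨fun h p => h p trivial, fun h p _ => h p⟩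
    exact := fun i => (N (i + 1)).genMatrix_spec.2.1
    -- The first matrix has entries in the proper ideal; the columns of the later ones are relations
    -- between minimal generators.
    minimal := fun i => by
      cases i with
      | zero => exact constantCoeff_genMatrix (N 0) fun v hv p => h0 _ (hv p trivial)
      | succ i => exact constantCoeff_genMatrix (N (i + 1)) (N i).genMatrix_spec.2.2 }⟩

end Resolution

/-! ### Socle degrees from the last module of the resolution. -/

section Socle

variable {K : Type*} [Field K] {n : ℕ}

/-- The vectors with all entries in the ideal `𝔞`. -/
def vecIdeal {A : Type*} [CommRing A] (𝔞 : Ideal A) (r : ℕ) : Submodule A (Fin r → A) :=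
  Submodule.pi Set.univ fun _ => 𝔞

lemma mem_vecIdeal {A : Type*} [CommRing A] {𝔞 : Ideal A} {r : ℕ} {v : Fin r → A} :
    v ∈ vecIdeal 𝔞 r ↔ ∀ p, v p ∈ 𝔞 :=
  ⟨fun h p => h p trivial, fun h p _ => h p⟩

lemma vecIdeal_mono {A : Type*} [CommRing A] {𝔞 𝔟 : Ideal A} (h : 𝔞 ≤ 𝔟) (r : ℕ) :
    vecIdeal 𝔞 r ≤ vecIdeal 𝔟 r :=
  fun _ hv p hp => h (hv p hp)

lemma mulVec_mem_vecIdeal {A : Type*} [CommRing A] {𝔞 : Ideal A} {r r' : ℕ}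
    (D : Matrix (Fin r) (Fin r') A) {v : Fin r' → A} (hv : v ∈ vecIdeal 𝔞 r') :
    D.mulVec v ∈ vecIdeal 𝔞 r :=
  mem_vecIdeal.2 fun p => show ∑ q, D p q * v q ∈ 𝔞 from
    sum_mem fun q _ => 𝔞.mul_mem_left _ (mem_vecIdeal.1 hv q)

lemma mulVec_mem_vecIdeal_of_forall {A : Type*} [CommRing A] {𝔞 : Ideal A} {r r' : ℕ}
    {D : Matrix (Fin r) (Fin r') A} (hD : ∀ p q, D p q ∈ 𝔞) (v : Fin r' → A) :
    D.mulVec v ∈ vecIdeal 𝔞 r :=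
  mem_vecIdeal.2 fun p => show ∑ q, D p q * v q ∈ 𝔞 from
    sum_mem fun q _ => 𝔞.mul_mem_right _ (hD p q)

/-- The ideal generated by the first `j` terms of a sequence. -/
def initialIdeal {A : Type*} [CommRing A] (y : ℕ → A) (j : ℕ) : Ideal A :=
  Ideal.span (y '' Set.Iio j)

section Initial

variable {A : Type*} [CommRing A] (y : ℕ → A)

lemma initialIdeal_zero : initialIdeal y 0 = ⊥ := by
  simp [initialIdeal]

lemma initialIdeal_mono {i j : ℕ} (h : i ≤ j) : initialIdeal y i ≤ initialIdeal y j :=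
  Ideal.span_mono (Set.image_mono (Set.Iio_subset_Iio h))

lemma mem_initialIdeal {i j : ℕ} (h : i < j) : y i ∈ initialIdeal y j :=
  Ideal.subset_span ⟨i, h, rfl⟩

lemma initialIdeal_succ (j : ℕ) :
    initialIdeal y (j + 1) = Ideal.span (insert (y j) (y '' Set.Iio j)) := by
  rw [initialIdeal, ← Set.image_insert_eq]
  congr 2
  ext i
  simp

lemma exists_of_mem_vecIdeal_succ {j r : ℕ} {v : Fin r → A}
    (hv : v ∈ vecIdeal (initialIdeal y (j + 1)) r) :
    ∃ u, v - y j • u ∈ vecIdeal (initialIdeal y j) r := by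
  have : ∀ p, ∃ u, v p - y j * u ∈ initialIdeal y j := by
    intro p
    have h := mem_vecIdeal.1 hv p
    rw [initialIdeal_succ, Ideal.mem_span_insert] at h
    obtain ⟨a, z, hz, h⟩ := h
    exact ⟨a, by rw [h, mul_comm, add_sub_cancel_left]; exact hz⟩
  choose u hu using this
  exact ⟨u, mem_vecIdeal.2 hu⟩

lemma smul_mem_vecIdeal {i j : ℕ} (h : i < j) {r : ℕ} (u : Fin r → A) :
    y i • u ∈ vecIdeal (initialIdeal y j) r :=
  mem_vecIdeal.2 fun _ => Ideal.mul_mem_right _ _ (mem_initialIdeal y h)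

end Initial

lemma vecComponent_mem_vecIdeal {𝔞 : Ideal (MvPolynomial (Fin (n + 1)) K)}
    (h𝔞 : IsGradedIdeal 𝔞) {r : ℕ} (s : Fin r → ℤ) (a : ℤ)
    {v : Fin r → MvPolynomial (Fin (n + 1)) K} (hv : v ∈ vecIdeal 𝔞 r) :
    vecComponent s a v ∈ vecIdeal 𝔞 r :=
  mem_vecIdeal.2 fun p => h𝔞 _ (mem_vecIdeal.1 hv p) _

/-- `y 0, …, y n` is a regular sequence of linear forms generating the irrelevant ideal of
`K[x₀, …, xₙ]` and `y 0` is a nonzerodivisor modulo `I`. -/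
structure IsParameterSequence (I : Ideal (MvPolynomial (Fin (n + 1)) K))
    (y : ℕ → MvPolynomial (Fin (n + 1)) K) : Prop where
  homogeneous : ∀ i, (y i).IsHomogeneous 1
  regular : ∀ j ≤ n, ∀ f, y j * f ∈ initialIdeal y j → f ∈ initialIdeal y j
  mem_of_mul_mem : ∀ f, y 0 * f ∈ I → f ∈ I
  irrelevant : ∀ f, f ∈ initialIdeal y (n + 1) ↔ constantCoeff f = 0

namespace IsParameterSequence

variable {I : Ideal (MvPolynomial (Fin (n + 1)) K)} {y : ℕ → MvPolynomial (Fin (n + 1)) K}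
  (hy : IsParameterSequence I y) (F : MinimalGradedFreeResolution I)
include hy

lemma isGradedIdeal (j : ℕ) : IsGradedIdeal (initialIdeal y j) :=
  isGradedIdeal_span (by rintro _ ⟨i, _, rfl⟩; exact ⟨1, hy.homogeneous i⟩)

lemma mem_vecIdeal_of_smul_mem {j r : ℕ} (hj : j ≤ n)
    {v : Fin r → MvPolynomial (Fin (n + 1)) K}
    (h : y j • v ∈ vecIdeal (initialIdeal y j) r) : v ∈ vecIdeal (initialIdeal y j) r :=
  mem_vecIdeal.2 fun p => hy.regular j hj _ (mem_vecIdeal.1 h p)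

omit hy in
lemma _root_.PointSets.mulVec_mulVec_eq_zero (i : ℕ)
    (w : Fin (F.rank (i + 1 + 1)) → MvPolynomial (Fin (n + 1)) K) :
    (F.d i).mulVec ((F.d (i + 1)).mulVec w) = 0 := by
  have : (F.d (i + 1)).mulVecLin w ∈ LinearMap.ker (F.d i).mulVecLin :=
    F.exact i ▸ LinearMap.mem_range_self _ _
  exact this

omit hy in
lemma _root_.PointSets.exists_mulVec_eq {i : ℕ}
    {v : Fin (F.rank (i + 1)) → MvPolynomial (Fin (n + 1)) K}
    (h : (F.d i).mulVec v = 0) : ∃ w, (F.d (i + 1)).mulVec w = v := by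
  have : v ∈ LinearMap.range (F.d (i + 1)).mulVecLin := by
    rw [F.exact i]
    exact h
  exact this

lemma ne_zero : y 0 ≠ 0 := by
  intro h
  have h1 := hy.regular 0 (Nat.zero_le _) 1 (by rw [h, zero_mul]; exact zero_mem _)
  rw [initialIdeal_zero] at h1
  exact one_ne_zero h1

/-- This says that y₀ is a nonzerodivisor on the cokernel of every differential: the first cokernel
is R/I, and the later ones embed in free modules. -/
lemma exists_mulVec_eq_of_smul (i : ℕ) {u : Fin (F.rank i) → MvPolynomial (Fin (n + 1)) K}
    {v : Fin (F.rank (i + 1)) → MvPolynomial (Fin (n + 1)) K}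
    (h : (F.d i).mulVec v = y 0 • u) : ∃ w, (F.d i).mulVec w = u := by
  cases i with
  | zero =>
    have h1 := (F.range_zero (y 0 • u)).1 ⟨v, h⟩
    exact (F.range_zero u).2 fun p => hy.mem_of_mul_mem _ (h1 p)
  | succ i =>
    refine exists_mulVec_eq F ?_
    have h1 := mulVec_mulVec_eq_zero F i v
    rw [h, Matrix.mulVec_smul] at h1
    exact (smul_eq_zero.1 h1).resolve_left hy.ne_zero

/-- The resolution modulo the first `j + 1` parameters is exact in degrees greater than `j`. -/
lemma exact_mod {j : ℕ} (hj : j ≤ n) : ∀ i ≥ j,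
    ∀ v : Fin (F.rank (i + 1)) → MvPolynomial (Fin (n + 1)) K,
    (F.d i).mulVec v ∈ vecIdeal (initialIdeal y (j + 1)) _ →
      ∃ w, v - (F.d (i + 1)).mulVec w ∈ vecIdeal (initialIdeal y (j + 1)) _ := by
  induction j with
  | zero =>
    intro i _ v hv
    obtain ⟨u, hu⟩ := exists_of_mem_vecIdeal_succ y hv
    have hu' : (F.d i).mulVec v = y 0 • u := by
      ext1 p
      have := mem_vecIdeal.1 hu p
      rw [initialIdeal_zero] at this
      exact sub_eq_zero.1 this
    obtain ⟨w, rfl⟩ := hy.exists_mulVec_eq_of_smul F i hu'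
    obtain ⟨z, hz⟩ := exists_mulVec_eq F (i := i) (v := v - y 0 • w)
      (by rw [Matrix.mulVec_sub, Matrix.mulVec_smul, hu', sub_self])
    refine ⟨z, ?_⟩
    rw [hz, sub_sub_cancel]
    exact smul_mem_vecIdeal y zero_lt_one _
  | succ j ih =>
    intro i hi v hv
    obtain ⟨i, rfl⟩ : ∃ k, i = k + 1 := ⟨i - 1, by omega⟩
    -- Modulo the earlier parameters dv = y_{j+1}u, so u is a cycle one step lower, hence u = dw.
    -- Then v - y_{j+1}w is a cycle and so a boundary. Using exactness one step lower costs one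
    -- degree for each parameter.
    obtain ⟨u, hu⟩ := exists_of_mem_vecIdeal_succ y hv
    have h1 : (F.d i).mulVec u ∈ vecIdeal (initialIdeal y (j + 1)) _ := by
      refine hy.mem_vecIdeal_of_smul_mem hj ?_
      have := mulVec_mem_vecIdeal (F.d i) hu
      rw [Matrix.mulVec_sub, mulVec_mulVec_eq_zero, zero_sub, Matrix.mulVec_smul] at this
      simpa using neg_mem this
    obtain ⟨w, hw⟩ := ih (by omega) i (by omega) u h1
    obtain ⟨z, hz⟩ := ih (by omega) (i + 1) (by omega) (v - y (j + 1) • w) (by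
      have := add_mem hu (Submodule.smul_mem _ (y (j + 1)) hw)
      rw [Matrix.mulVec_sub, Matrix.mulVec_smul]
      convert! this using 1
      rw [smul_sub]
      abel)
    refine ⟨z, ?_⟩
    have := add_mem (vecIdeal_mono (initialIdeal_mono y (Nat.le_succ (j + 1))) _ hz)
      (smul_mem_vecIdeal y (Nat.lt_succ_self (j + 1)) w)
    convert! this using 1
    abel

end IsParameterSequence

/-- `u` lies in the image of the differential modulo the first `j + 1` parameters. -/
def IsBoundaryMod {I : Ideal (MvPolynomial (Fin (n + 1)) K)}
    (F : MinimalGradedFreeResolution I) (y : ℕ → MvPolynomial (Fin (n + 1)) K) (j : ℕ)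
    (u : Fin (F.rank j) → MvPolynomial (Fin (n + 1)) K) : Prop :=
  ∃ w, u - (F.d j).mulVec w ∈ vecIdeal (initialIdeal y (j + 1)) _

/-- The cokernel of `Fⱼ₊₁ → Fⱼ` modulo the first `j + 1` parameters has a nonzero socle element
of degree `a`. -/
def HasSocleElement {I : Ideal (MvPolynomial (Fin (n + 1)) K)}
    (F : MinimalGradedFreeResolution I) (y : ℕ → MvPolynomial (Fin (n + 1)) K) (j : ℕ)
    (a : ℤ) : Prop :=
  ∃ u, vecComponent (F.shift j) a u = u ∧ (∀ i ≤ n, IsBoundaryMod F y j (y i • u)) ∧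
    ¬ IsBoundaryMod F y j u

namespace IsParameterSequence

variable {I : Ideal (MvPolynomial (Fin (n + 1)) K)} {y : ℕ → MvPolynomial (Fin (n + 1)) K}
  (hy : IsParameterSequence I y) (F : MinimalGradedFreeResolution I)
include hy

/-- The connecting map: y_{j+1} kills the socle element u, so y_{j+1}u = dv modulo the earlier
parameters, and v is the new socle element. Linearity of y_{j+1} raises the degree by one. -/
lemma hasSocleElement_succ {j : ℕ} (hj : j < n) {a : ℤ} (h : HasSocleElement F y j a) :
    HasSocleElement F y (j + 1) (a + 1) := by
  obtain ⟨u, hu, hsoc, hnb⟩ := h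
  obtain ⟨v, hv⟩ := hsoc (j + 1) hj
  have hcomp := vecComponent_mem_vecIdeal (hy.isGradedIdeal (j + 1)) (F.shift j) (a + 1) hv
  have h1 := vecComponent_smul (F.shift j) (hy.homogeneous (j + 1)) a u
  rw [Nat.cast_one] at h1
  rw [map_sub, h1, hu, IsGradedMatrix.vecComponent_mulVec (F.homogeneous j)] at hcomp
  refine ⟨vecComponent (F.shift (j + 1)) (a + 1) v, vecComponent_idem _ _ _, ?_, ?_⟩
  · generalize vecComponent (F.shift (j + 1)) (a + 1) v = v at hcomp
    intro i hi
    obtain ⟨w, hw⟩ := hsoc i hi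
    -- Both terms map to yᵢy_{j+1}u, so the difference is a cycle.
    have h2 : (F.d j).mulVec (y i • v - y (j + 1) • w) ∈ vecIdeal (initialIdeal y (j + 1)) _ := by
      have := sub_mem (Submodule.smul_mem _ (y (j + 1)) hw) (Submodule.smul_mem _ (y i) hcomp)
      convert! this using 1
      rw [Matrix.mulVec_sub, Matrix.mulVec_smul, Matrix.mulVec_smul, smul_sub, smul_sub,
        smul_comm (y i)]
      abel
    obtain ⟨z, hz⟩ := hy.exact_mod F (by omega) j le_rfl _ h2
    refine ⟨z, ?_⟩
    have := add_mem (vecIdeal_mono (initialIdeal_mono y (Nat.le_succ (j + 1))) _ hz)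
      (smul_mem_vecIdeal y (Nat.lt_succ_self (j + 1)) w)
    convert! this using 1
    abel
  · generalize vecComponent (F.shift (j + 1)) (a + 1) v = v at hcomp
    -- If v = dz + y_{j+1}w, then y_{j+1}u = y_{j+1}dw, and cancelling y_{j+1} makes u a boundary.
    rintro ⟨z, hz⟩
    obtain ⟨w, hw⟩ := exists_of_mem_vecIdeal_succ y hz
    refine hnb ⟨w, hy.mem_vecIdeal_of_smul_mem (j := j + 1) hj ?_⟩
    have := add_mem hcomp (mulVec_mem_vecIdeal (F.d j) hw)
    convert! this using 1
    rw [Matrix.mulVec_sub, Matrix.mulVec_sub, mulVec_mulVec_eq_zero, Matrix.mulVec_smul, smul_sub]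
    abel

/-- The inverse of the connecting map: dv is divisible by y_{j+1} modulo the earlier parameters, and
the quotient u is the socle element one step lower. -/
lemma hasSocleElement_of_succ {j : ℕ} (hj : j < n) {a : ℤ}
    (h : HasSocleElement F y (j + 1) (a + 1)) : HasSocleElement F y j a := by
  obtain ⟨v, hv, hsoc, hnb⟩ := h
  -- If a further parameter y_{j+2} exists, it kills v modulo boundaries, so it kills dv and can be
  -- cancelled. At the last step there is none, and minimality of the resolution replaces it.
  have hDv : (F.d j).mulVec v ∈ vecIdeal (initialIdeal y (j + 1 + 1)) _ := by
    rcases Nat.lt_or_ge (j + 1) n with hjn | hjn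
    · obtain ⟨w, hw⟩ := hsoc (j + 2) hjn
      refine hy.mem_vecIdeal_of_smul_mem hjn ?_
      have := mulVec_mem_vecIdeal (F.d j) hw
      rwa [Matrix.mulVec_sub, mulVec_mulVec_eq_zero, sub_zero, Matrix.mulVec_smul] at this
    · obtain rfl : j + 1 = n := le_antisymm hj hjn
      exact mulVec_mem_vecIdeal_of_forall (fun p q => (hy.irrelevant _).2 (F.minimal j p q)) v
  obtain ⟨u, hu⟩ := exists_of_mem_vecIdeal_succ y hDv
  have hcomp := vecComponent_mem_vecIdeal (hy.isGradedIdeal (j + 1)) (F.shift j) (a + 1) hu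
  have h1 := vecComponent_smul (F.shift j) (hy.homogeneous (j + 1)) a u
  rw [Nat.cast_one] at h1
  rw [map_sub, h1, IsGradedMatrix.vecComponent_mulVec (F.homogeneous j), hv] at hcomp
  refine ⟨vecComponent (F.shift j) a u, vecComponent_idem _ _ _, ?_, ?_⟩
  · generalize vecComponent (F.shift j) a u = u at hcomp
    intro i hi
    obtain ⟨w, hw⟩ := hsoc i hi
    obtain ⟨t, ht⟩ := exists_of_mem_vecIdeal_succ y hw
    refine ⟨t, hy.mem_vecIdeal_of_smul_mem (j := j + 1) hj ?_⟩
    have := sub_mem (mulVec_mem_vecIdeal (F.d j) ht) (Submodule.smul_mem _ (y i) hcomp)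
    convert! this using 1
    rw [Matrix.mulVec_sub, Matrix.mulVec_sub, mulVec_mulVec_eq_zero, Matrix.mulVec_smul,
      Matrix.mulVec_smul, smul_sub, smul_sub, smul_comm (y i) (y (j + 1))]
    abel
  · generalize vecComponent (F.shift j) a u = u at hcomp
    rintro ⟨w, hw⟩
    have h2 : (F.d j).mulVec (v - y (j + 1) • w) ∈ vecIdeal (initialIdeal y (j + 1)) _ := by
      have := add_mem hcomp (Submodule.smul_mem _ (y (j + 1)) hw)
      convert! this using 1
      rw [Matrix.mulVec_sub, Matrix.mulVec_smul, smul_sub]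
      abel
    obtain ⟨z, hz⟩ := hy.exact_mod F (by omega) j le_rfl _ h2
    refine hnb ⟨z, ?_⟩
    have := add_mem (vecIdeal_mono (initialIdeal_mono y (Nat.le_succ (j + 1))) _ hz)
      (smul_mem_vecIdeal y (Nat.lt_succ_self (j + 1)) w)
    convert! this using 1
    abel

lemma hasSocleElement_iff {j : ℕ} (hj : j ≤ n) {a : ℤ} :
    HasSocleElement F y j (a + j) ↔ HasSocleElement F y 0 a := by
  induction j with
  | zero => simp
  | succ j ih =>
    rw [← ih (by omega), Nat.cast_succ, ← add_assoc]
    exact ⟨hy.hasSocleElement_of_succ F hj, hy.hasSocleElement_succ F hj⟩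

/-- Modulo all parameters the differentials vanish by minimality. What remains is Fₙ ⊗ K, which is
all socle and has one basis element in the degree of each shift. -/
lemma hasSocleElement_last_iff {a : ℤ} :
    HasSocleElement F y n a ↔ ∃ p, F.shift n p = a := by
  have hD : ∀ w, (F.d n).mulVec w ∈ vecIdeal (initialIdeal y (n + 1)) _ :=
    mulVec_mem_vecIdeal_of_forall (fun p q => (hy.irrelevant _).2 (F.minimal n p q))
  have hb : ∀ u, IsBoundaryMod F y n u ↔ ∀ p, constantCoeff (u p) = 0 := by
    intro u
    simp_rw [← hy.irrelevant, ← mem_vecIdeal]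
    exact ⟨fun ⟨w, hw⟩ => by simpa using add_mem hw (hD w), fun h => ⟨0, by simpa using h⟩⟩
  constructor
  · rintro ⟨u, hu, -, hnb⟩
    rw [hb] at hnb
    push Not at hnb
    obtain ⟨p, hp⟩ := hnb
    refine ⟨p, ?_⟩
    by_contra hne
    have h1 := congrArg (coeff 0) (congrFun hu p)
    rw [vecComponent_apply, coeff_intComponent, if_neg (by simp; omega)] at h1
    exact hp h1.symm
  · rintro ⟨p, rfl⟩
    classical
    refine ⟨Pi.single p 1, ?_, ?_, ?_⟩
    · ext1 q
      rw [vecComponent_apply]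
      by_cases hq : q = p
      · subst hq
        rw [Pi.single_eq_same, sub_self, intComponent_zero, map_one, C_1]
      · rw [Pi.single_eq_of_ne hq, map_zero]
    · intro i hi
      rw [hb]
      intro q
      rw [Pi.smul_apply, smul_eq_mul, map_mul,
        (hy.irrelevant _).1 (mem_initialIdeal y (Nat.lt_succ_of_le hi)), zero_mul]
    · rw [hb]
      push Not
      exact ⟨p, by simp⟩

omit hy in
lemma _root_.PointSets.hasSocleElement_zero_iff {a : ℤ} :
    HasSocleElement F y 0 a ↔ ∃ f, intComponent a f = f ∧
      (∀ i ≤ n, y i * f ∈ I ⊔ Ideal.span {y 0}) ∧ f ∉ I ⊔ Ideal.span {y 0} := by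
  have hsub : Subsingleton (Fin (F.rank 0)) := by rw [F.rank_zero]; infer_instance
  have p₀ : Fin (F.rank 0) := ⟨0, by rw [F.rank_zero]; exact zero_lt_one⟩
  have hb : ∀ u, IsBoundaryMod F y 0 u ↔ u p₀ ∈ I ⊔ Ideal.span {y 0} := by
    intro u
    have h1 : initialIdeal y (0 + 1) = Ideal.span {y 0} := by
      rw [initialIdeal_succ]
      simp
    unfold IsBoundaryMod
    rw [h1, Submodule.mem_sup]
    constructor
    · rintro ⟨w, hw⟩
      exact ⟨_, (F.range_zero _).1 ⟨w, rfl⟩ p₀, _, mem_vecIdeal.1 hw p₀, by simp⟩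
    · rintro ⟨f, hf, g, hg, hfg⟩
      obtain ⟨w, hw⟩ := (F.range_zero fun _ => f).2 fun _ => hf
      refine ⟨w, mem_vecIdeal.2 fun p => ?_⟩
      rw [← Matrix.mulVecLin_apply, hw, Pi.sub_apply, Subsingleton.elim p p₀, ← hfg,
        add_sub_cancel_left]
      exact hg
  constructor
  · rintro ⟨u, hu, hsoc, hnb⟩
    refine ⟨u p₀, ?_, fun i hi => (hb _).1 (hsoc i hi), fun h => hnb ((hb _).2 h)⟩
    have := congrFun hu p₀
    rwa [vecComponent_apply, F.shift_zero, sub_zero] at this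
  · rintro ⟨f, hf, hsoc, hnb⟩
    refine ⟨fun _ => f, ?_, fun i hi => (hb _).2 (hsoc i hi), fun h => hnb ((hb _).1 h)⟩
    ext1 p
    rw [vecComponent_apply, F.shift_zero, sub_zero, hf]

end IsParameterSequence

/-- The socle degrees of `R/I(Γ)` are the degrees of the socle elements of the quotient of `R/I(Γ)`
by a linear nonzerodivisor. -/
lemma mem_socleDegrees_iff {Γ : Set (ℙ K (Fin (n + 1) → K))} (hΓ : Γ.Nonempty)
    {y : ℕ → MvPolynomial (Fin (n + 1)) K} (hy : IsParameterSequence (idealOf Γ) y) {c : ℤ} :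
    c ∈ socleDegrees Γ ↔ ∃ f, intComponent c f = f ∧
      (∀ i ≤ n, y i * f ∈ idealOf Γ ⊔ Ideal.span {y 0}) ∧
        f ∉ idealOf Γ ⊔ Ideal.span {y 0} := by
  -- The right side does not involve `F`, so all resolutions have the same degrees in Fₙ. Existence
  -- of a resolution is needed only to realise a given socle element.
  have key : ∀ F : MinimalGradedFreeResolution (idealOf Γ),
      (∃ p, c = F.shift n p - n) ↔ ∃ f, intComponent c f = f ∧
      (∀ i ≤ n, y i * f ∈ idealOf Γ ⊔ Ideal.span {y 0}) ∧
        f ∉ idealOf Γ ⊔ Ideal.span {y 0} := by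
    intro F
    rw [← hasSocleElement_zero_iff F, ← hy.hasSocleElement_iff F le_rfl,
      hy.hasSocleElement_last_iff]
    exact exists_congr fun p => ⟨fun h => by omega, fun h => by omega⟩
  obtain ⟨F⟩ := nonempty_minimalGradedFreeResolution (isGradedIdeal_idealOf Γ)
    fun f hf => constantCoeff_of_mem_idealOf hΓ hf
  rw [← key F]
  constructor
  · rintro ⟨F', p, hp⟩
    rw [key F, ← key F']
    exact ⟨p, hp⟩
  · rintro ⟨p, hp⟩
    exact ⟨F, p, hp⟩

end Socle

open Module

/-! ### Linear changes of coordinates and ideals of linear subspaces. -/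

section LinearForms

variable {σ K : Type*} [Field K] [Fintype σ] [DecidableEq σ]

/-- The linear form defined by a linear functional. -/
def linForm (φ : Dual K (σ → K)) : MvPolynomial σ K :=
  ∑ i, C (φ (Pi.single i 1)) * X i

lemma eval_linForm (φ : Dual K (σ → K)) (w : σ → K) : eval w (linForm φ) = φ w := by
  rw [linForm, map_sum, φ.pi_apply_eq_sum_univ w]
  refine Finset.sum_congr rfl fun i _ => ?_
  rw [map_mul, eval_C, eval_X, smul_eq_mul, mul_comm]
  congr 2
  ext j
  simp [Pi.single_apply, eq_comm]

lemma isHomogeneous_linForm (φ : Dual K (σ → K)) : (linForm φ).IsHomogeneous 1 :=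
  IsHomogeneous.sum _ _ _ fun i _ => isHomogeneous_C_mul_X _ i

lemma linForm_sum_smul {ι : Type*} (s : Finset ι) (c : ι → K) (φ : ι → Dual K (σ → K)) :
    linForm (∑ i ∈ s, c i • φ i) = ∑ i ∈ s, C (c i) * linForm (φ i) := by
  simp only [linForm, LinearMap.sum_apply, LinearMap.smul_apply, smul_eq_mul, map_sum, map_mul,
    Finset.sum_mul, Finset.mul_sum, mul_assoc]
  exact Finset.sum_comm

lemma linForm_proj (i : σ) : linForm (LinearMap.proj i : Dual K (σ → K)) = X i := by
  rw [linForm, Finset.sum_eq_single i]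
  · simp
  · intro j _ hj
    simp [hj.symm]
  · simp

variable (φ : Basis σ K (Dual K (σ → K)))

omit [DecidableEq σ] in
lemma exists_forall_apply_eq (x : σ → K) : ∃ w, ∀ i, φ i w = x i := by
  refine ⟨(evalEquiv K (σ → K)).symm (φ.constr K x), fun i => ?_⟩
  rw [apply_evalEquiv_symm_apply, Basis.constr_basis]

/-- The linear change of coordinates of a polynomial ring given by a basis of linear forms. -/
def changeCoords : MvPolynomial σ K →ₐ[K] MvPolynomial σ K :=
  aeval fun i => linForm (φ i)

@[simp]
lemma changeCoords_X (i : σ) : changeCoords φ (X i) = linForm (φ i) := by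
  simp [changeCoords]

lemma eval_changeCoords (w : σ → K) (f : MvPolynomial σ K) :
    eval w (changeCoords φ f) = eval (fun i => φ i w) f := by
  induction f using MvPolynomial.induction_on with
  | C a => simp [changeCoords, algebraMap_eq]
  | add p q hp hq => simp [hp, hq]
  | mul_X p i hp => simp [hp, eval_linForm]

lemma changeCoords_bijective [Infinite K] : Function.Bijective (changeCoords φ) := by
  constructor
  · rw [injective_iff_map_eq_zero]
    intro f hf
    refine MvPolynomial.funext fun x => ?_
    obtain ⟨w, hw⟩ := exists_forall_apply_eq φ x
    rw [← _root_.funext hw, ← eval_changeCoords, hf, map_zero, map_zero]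
  · rw [← AlgHom.range_eq_top, eq_top_iff, ← MvPolynomial.adjoin_range_X, Algebra.adjoin_le_iff]
    rintro _ ⟨i, rfl⟩
    refine ⟨∑ j, C (φ.repr (LinearMap.proj i) j) * X j, ?_⟩
    rw [← linForm_proj i]
    conv_rhs => rw [← φ.sum_repr (LinearMap.proj i), linForm_sum_smul]
    simp [changeCoords, algebraMap_eq]

/-- The ideal generated by the forms of a basis with index in `s`. -/
def formIdeal (s : Set σ) : Ideal (MvPolynomial σ K) :=
  Ideal.span ((fun i => linForm (φ i)) '' s)

lemma linForm_mem_formIdeal {s : Set σ} {i : σ} (hi : i ∈ s) : linForm (φ i) ∈ formIdeal φ s :=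
  Ideal.subset_span ⟨i, hi, rfl⟩

lemma formIdeal_mono {s t : Set σ} (h : s ⊆ t) : formIdeal φ s ≤ formIdeal φ t :=
  Ideal.span_mono (Set.image_mono h)

lemma formIdeal_singleton (i : σ) : formIdeal φ {i} = Ideal.span {linForm (φ i)} := by
  rw [formIdeal, Set.image_singleton]

lemma mem_formIdeal_insert {s : Set σ} {i : σ} {f : MvPolynomial σ K} :
    f ∈ formIdeal φ (insert i s) ↔ ∃ a, ∃ b ∈ formIdeal φ s, f = a * linForm (φ i) + b := by
  rw [formIdeal, Set.image_insert_eq, Ideal.mem_span_insert]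
  rfl

lemma isGradedIdeal_formIdeal (s : Set σ) : IsGradedIdeal (formIdeal φ s) :=
  isGradedIdeal_span (by rintro _ ⟨i, _, rfl⟩; exact ⟨1, isHomogeneous_linForm _⟩)

lemma changeCoords_mem_formIdeal [Infinite K] (s : Set σ) (f : MvPolynomial σ K) :
    changeCoords φ f ∈ formIdeal φ s ↔ f ∈ Ideal.span (X '' s : Set (MvPolynomial σ K)) := by
  have h : formIdeal φ s = Ideal.map (changeCoords φ) (Ideal.span (X '' s)) := by
    rw [Ideal.map_span, Set.image_image, formIdeal]
    simp
  rw [h, ← Ideal.mem_comap, Ideal.comap_map_of_bijective _ (changeCoords_bijective φ)]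

/-- In the coordinates φ the ideal is generated by variables, so membership means that each monomial
contains a variable from `s`. Multiplication by a different variable does not affect this. -/
lemma mem_formIdeal_of_mul_mem [Infinite K] {s : Set σ} {i : σ} (hi : i ∉ s)
    {f : MvPolynomial σ K} (h : linForm (φ i) * f ∈ formIdeal φ s) : f ∈ formIdeal φ s := by
  obtain ⟨g, rfl⟩ := (changeCoords_bijective φ).2 f
  rw [← changeCoords_X, ← map_mul, changeCoords_mem_formIdeal, mem_ideal_span_X_image] at h
  rw [changeCoords_mem_formIdeal, mem_ideal_span_X_image]
  intro m hm
  obtain ⟨j, hj, hmj⟩ := h (Finsupp.single i 1 + m) (by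
    rw [MvPolynomial.mem_support_iff, mul_comm, add_comm, coeff_mul_X]
    exact MvPolynomial.mem_support_iff.1 hm)
  refine ⟨j, hj, ?_⟩
  have hij : i ≠ j := fun h => hi (h ▸ hj)
  simpa [Finsupp.single_apply, hij] using hmj

lemma eval_eq_zero_of_mem_formIdeal {s : Set σ} {f : MvPolynomial σ K} (hf : f ∈ formIdeal φ s)
    {w : σ → K} (hw : ∀ i ∈ s, φ i w = 0) : eval w f = 0 := by
  have : formIdeal φ s ≤ RingHom.ker (eval w) := by
    refine Ideal.span_le.2 ?_
    rintro _ ⟨i, hi, rfl⟩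
    exact (eval_linForm _ _).trans (hw i hi)
  exact this hf

/-- A polynomial vanishing on a linear subspace lies in the ideal of its linear equations. -/
lemma mem_formIdeal_of_forall_eval_eq_zero [Infinite K] {s : Set σ} {f : MvPolynomial σ K}
    (h : ∀ w, (∀ i ∈ s, φ i w = 0) → eval w f = 0) : f ∈ formIdeal φ s := by
  classical
  obtain ⟨g, rfl⟩ := (changeCoords_bijective φ).2 f
  rw [changeCoords_mem_formIdeal]
  -- `π` restricts to the subspace by setting the variables in `s` to zero; `π g` vanishes as a
  -- function, hence as a polynomial over an infinite field.
  let π : MvPolynomial σ K →ₐ[K] MvPolynomial σ K := aeval fun i => if i ∈ s then 0 else X i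
  have hπ : ∀ p : MvPolynomial σ K, p - π p ∈ Ideal.span (X '' s : Set (MvPolynomial σ K)) := by
    intro p
    induction p using MvPolynomial.induction_on with
    | C a => simp [π, algebraMap_eq]
    | add p q hp hq =>
      rw [map_add, add_sub_add_comm]
      exact add_mem hp hq
    | mul_X p i hp =>
      have h1 : X i - π (X i) ∈ Ideal.span (X '' s : Set (MvPolynomial σ K)) := by
        by_cases hi : i ∈ s
        · simpa [π, hi] using Ideal.subset_span (Set.mem_image_of_mem X hi)
        · simp [π, hi]
      have : p * X i - π (p * X i) = (p - π p) * X i + π p * (X i - π (X i)) := by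
        rw [map_mul]
        ring
      rw [this]
      exact add_mem (Ideal.mul_mem_right _ _ hp) (Ideal.mul_mem_left _ _ h1)
  have h0 : π g = 0 := by
    refine MvPolynomial.funext fun x => ?_
    obtain ⟨w, hw⟩ := exists_forall_apply_eq φ fun i => if i ∈ s then 0 else x i
    have h1 := h w fun i hi => by rw [hw, if_pos hi]
    rw [eval_changeCoords, _root_.funext hw] at h1
    have h2 : eval x (π g) = eval (fun i => if i ∈ s then 0 else x i) g := by
      have : (eval x).comp π.toRingHom = eval (fun i => if i ∈ s then 0 else x i) := by
        refine MvPolynomial.ringHom_ext (by simp [π, algebraMap_eq]) fun i => ?_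
        by_cases hi : i ∈ s <;> simp [π, hi]
      exact congrArg (fun F => F g) this
    rw [h2, h1, map_zero]
  simpa [h0] using hπ g

lemma mem_formIdeal_univ_iff [Infinite K] {f : MvPolynomial σ K} :
    f ∈ formIdeal φ Set.univ ↔ constantCoeff f = 0 := by
  have key : ∀ f : MvPolynomial σ K, constantCoeff f = eval 0 f := fun f => by simp
  rw [key]
  refine ⟨fun h => eval_eq_zero_of_mem_formIdeal φ h fun i _ => map_zero _, fun h =>
    mem_formIdeal_of_forall_eval_eq_zero φ fun w hw => ?_⟩
  have hw0 : w = 0 := by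
    rw [← forall_dual_apply_eq_zero_iff K]
    intro ψ
    rw [← φ.sum_repr ψ, LinearMap.sum_apply]
    exact Finset.sum_eq_zero fun i _ => by rw [LinearMap.smul_apply, hw i trivial, smul_zero]
  rw [hw0, h]

end LinearForms

/-! ### Coordinates adapted to the hyperplane and the line. -/

section Frames

variable {K : Type*} [Field K] {n : ℕ}

/-- A basis of linear forms as a sequence. -/
def formSeq (φ : Basis (Fin (n + 1)) K (Dual K (Fin (n + 1) → K))) (i : ℕ) :
    MvPolynomial (Fin (n + 1)) K :=
  if h : i < n + 1 then linForm (φ ⟨i, h⟩) else 0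

lemma formSeq_val (φ : Basis (Fin (n + 1)) K (Dual K (Fin (n + 1) → K))) (i : Fin (n + 1)) :
    formSeq φ i = linForm (φ i) := by
  rw [formSeq, dif_pos i.2]

lemma initialIdeal_formSeq (φ : Basis (Fin (n + 1)) K (Dual K (Fin (n + 1) → K))) {j : ℕ}
    (hj : j ≤ n + 1) : initialIdeal (formSeq φ) j = formIdeal φ {i | i.val < j} := by
  unfold initialIdeal formIdeal
  congr 1
  ext f
  constructor
  · rintro ⟨i, hi, rfl⟩
    have hi' : i < j := hi
    exact ⟨⟨i, by omega⟩, hi, (formSeq_val φ ⟨i, by omega⟩).symm⟩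
  · rintro ⟨i, hi, rfl⟩
    exact ⟨i, hi, formSeq_val φ i⟩

lemma isParameterSequence_formSeq [Infinite K] {Γ : Set (ℙ K (Fin (n + 1) → K))}
    (φ : Basis (Fin (n + 1)) K (Dual K (Fin (n + 1) → K)))
    (hφ : ∀ P ∈ Γ, φ 0 P.rep ≠ 0) : IsParameterSequence (idealOf Γ) (formSeq φ) where
  homogeneous i := by
    unfold formSeq
    split_ifs
    · exact isHomogeneous_linForm _
    · exact isHomogeneous_zero _ _ _
  regular j hj f hf := by
    rw [initialIdeal_formSeq φ (by omega)] at hf ⊢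
    have h := formSeq_val φ ⟨j, by omega⟩
    rw [show formSeq φ j = linForm (φ ⟨j, by omega⟩) from h] at hf
    exact mem_formIdeal_of_mul_mem φ (by simp) hf
  mem_of_mul_mem f hf := by
    rw [show formSeq φ 0 = linForm (φ 0) from formSeq_val φ 0] at hf
    exact mem_idealOf_of_mul_mem (isHomogeneous_linForm _)
      (fun P hP => by rw [eval_linForm]; exact hφ P hP) hf
  irrelevant f := by
    rw [initialIdeal_formSeq φ le_rfl, ← mem_formIdeal_univ_iff φ]
    congr! 2
    ext i
    simpa using i.2

/-- The socle degrees in terms of a basis of linear forms, the first of which vanishes at none of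
the points. -/
lemma mem_socleDegrees_iff_forms [Infinite K] {Γ : Set (ℙ K (Fin (n + 1) → K))}
    (hΓ : Γ.Nonempty) (φ : Basis (Fin (n + 1)) K (Dual K (Fin (n + 1) → K)))
    (hφ : ∀ P ∈ Γ, φ 0 P.rep ≠ 0) {c : ℤ} :
    c ∈ socleDegrees Γ ↔ ∃ k : ℕ, c = k ∧ ∃ f : MvPolynomial (Fin (n + 1)) K,
      f.IsHomogeneous k ∧
      (∀ i, linForm (φ i) * f ∈ idealOf Γ ⊔ Ideal.span {linForm (φ 0)}) ∧
        f ∉ idealOf Γ ⊔ Ideal.span {linForm (φ 0)} := by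
  rw [mem_socleDegrees_iff hΓ (isParameterSequence_formSeq φ hφ),
    show formSeq φ 0 = linForm (φ 0) from formSeq_val φ 0]
  constructor
  · rintro ⟨f, hf, hsoc, hnot⟩
    rcases lt_or_ge c 0 with hc | hc
    · rw [← hf, intComponent_of_neg hc] at hnot
      exact absurd (zero_mem _) hnot
    · lift c to ℕ using hc
      refine ⟨c, rfl, f, ?_, fun i => formSeq_val φ i ▸ hsoc i (Nat.lt_succ_iff.1 i.2), hnot⟩
      have := isHomogeneous_intComponent (c : ℤ) f
      rwa [hf] at this
  · rintro ⟨k, rfl, f, hf, hsoc, hnot⟩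
    refine ⟨f, by rw [intComponent_of_isHomogeneous hf, if_pos rfl], fun i hi => ?_, hnot⟩
    exact (formSeq_val φ ⟨i, by omega⟩).symm ▸ hsoc ⟨i, by omega⟩

lemma exists_dual_mem_iff_apply_eq_zero {H : Submodule K (Fin (n + 1) → K)}
    (hH : finrank K H = n) : ∃ h : Dual K (Fin (n + 1) → K), ∀ w, w ∈ H ↔ h w = 0 := by
  have hlt : H < ⊤ := by
    rw [lt_top_iff_ne_top]
    rintro rfl
    simp at hH
  obtain ⟨h, h0, hle⟩ := Submodule.exists_le_ker_of_lt_top H hlt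
  refine ⟨h, fun w => ?_⟩
  rw [← LinearMap.mem_ker, Submodule.eq_of_le_of_finrank_eq hle]
  have := Dual.finrank_ker_add_one_of_ne_zero h0
  simp at this
  omega

lemma exists_linearIndependent_span_eq {E : Type*} [AddCommGroup E] [Module K E]
    [FiniteDimensional K E] {W : Submodule K E} {m : ℕ} (hW : finrank K W = m) :
    ∃ ψ : Fin m → E, LinearIndependent K ψ ∧ Submodule.span K (Set.range ψ) = W := by
  let b := finBasisOfFinrankEq K W hW
  refine ⟨fun i => b i, b.linearIndependent.map' W.subtype W.ker_subtype, ?_⟩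
  have := congrArg (Submodule.map W.subtype) b.span_eq
  rwa [Submodule.map_span, ← Set.range_comp, Submodule.map_top, Submodule.range_subtype] at this

lemma apply_eq_zero_of_mem_span {E ι : Type*} [AddCommGroup E] [Module K E] {f : ι → Dual K E}
    {w : E} (hf : ∀ i, f i w = 0) {χ : Dual K E} (hχ : χ ∈ Submodule.span K (Set.range f)) :
    χ w = 0 := by
  have : Submodule.span K (Set.range f) ≤ LinearMap.ker (Dual.eval K _ w) :=
    Submodule.span_le.2 (by rintro _ ⟨i, rfl⟩; exact hf i)
  exact this hχ

lemma exists_basis_coe_eq {E : Type*} [AddCommGroup E] [Module K E] [FiniteDimensional K E]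
    {m : ℕ} (hE : finrank K E = m) {f : Fin m → E} (hf : LinearIndependent K f) :
    ∃ b : Basis (Fin m) K E, ⇑b = f := by
  cases m with
  | zero =>
    have := finrank_zero_iff.1 hE
    exact ⟨Basis.empty E, _root_.funext fun i => i.elim0⟩
  | succ m =>
    exact ⟨basisOfLinearIndependentOfCardEqFinrank hf (by simp [hE]),
      coe_basisOfLinearIndependentOfCardEqFinrank _ _⟩

/-- Linear coordinates adapted to a hyperplane `H` and a line `L` not contained in it: `φ 1` is the
equation of `H`, the `φ i` with `i ≥ 2` are equations of `L`, and `φ 0` vanishes at none of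
finitely many given points. -/
lemma exists_adapted_basis [Infinite K] (hn : 1 ≤ n) {H L : Submodule K (Fin (n + 1) → K)}
    (hH : finrank K H = n) (hL : finrank K L = 2) (hLH : ¬ L ≤ H)
    {Γ : Set (ℙ K (Fin (n + 1) → K))} (hΓ : Γ.Finite) :
    ∃ φ : Basis (Fin (n + 1)) K (Dual K (Fin (n + 1) → K)),
      (∀ w, w ∈ H ↔ φ 1 w = 0) ∧ (∀ w, w ∈ L ↔ ∀ i, i ≠ 0 → i ≠ 1 → φ i w = 0) ∧
        ∀ P ∈ Γ, φ 0 P.rep ≠ 0 := by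
  obtain ⟨m, rfl⟩ : ∃ m, n = m + 1 := ⟨n - 1, by omega⟩
  obtain ⟨h, hh⟩ := exists_dual_mem_iff_apply_eq_zero hH
  obtain ⟨e, heL, heH⟩ := SetLike.not_le_iff_exists.1 hLH
  obtain ⟨q, hq, hq0⟩ : ∃ q ∈ H ⊓ L, q ≠ 0 := by
    rw [← Submodule.ne_bot_iff]
    intro hbot
    have h1 := Submodule.finrank_sup_add_finrank_inf_eq H L
    have h2 := Submodule.finrank_le (H ⊔ L)
    rw [hbot, hH, hL, finrank_bot] at h1
    simp at h2
    omega
  have := hΓ.to_subtype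
  have := Fintype.ofFinite Γ
  -- The point q of H ∩ L is added to the given points: the equations of H and L all vanish at q, so
  -- l(q) ≠ 0 makes l independent of them.
  obtain ⟨l, hl⟩ := exists_dual_forall_apply_ne_zero (K := K)
    (fun o : Option Γ => o.elim q fun P => P.1.rep) (by
      rintro (_ | P)
      · exact hq0
      · exact P.1.rep_nonzero)
  have hann : finrank K L.dualAnnihilator = m := by
    have := Subspace.finrank_add_finrank_dualAnnihilator_eq L
    simp at this
    omega
  obtain ⟨ψ, hψ, hψs⟩ := exists_linearIndependent_span_eq hann
  have hψL : ∀ w, w ∈ L ↔ ∀ i, ψ i w = 0 := by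
    intro w
    rw [← Subspace.forall_mem_dualAnnihilator_apply_eq_zero_iff, ← hψs]
    refine ⟨fun hw i => hw _ (Submodule.subset_span ⟨i, rfl⟩), fun hw χ hχ => ?_⟩
    exact apply_eq_zero_of_mem_span hw hχ
  have hli : LinearIndependent K
      (Fin.cons l (Fin.cons h ψ) : Fin (m + 1 + 1) → Dual K (Fin (m + 1 + 1) → K)) := by
    refine linearIndependent_finCons.2 ⟨linearIndependent_finCons.2 ⟨hψ, fun hmem => ?_⟩,
      fun hmem => ?_⟩
    · exact heH ((hh e).2 (apply_eq_zero_of_mem_span ((hψL e).1 heL) hmem))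
    · refine hl none (apply_eq_zero_of_mem_span (fun i => ?_) hmem)
      refine Fin.cases ?_ (fun i => ?_) i
      · exact (hh q).1 hq.1
      · exact (hψL q).1 hq.2 i
  obtain ⟨φ, hφ⟩ := exists_basis_coe_eq (by simp) hli
  refine ⟨φ, ?_, ?_, ?_⟩
  · intro w
    rw [hφ]
    exact hh w
  · intro w
    rw [hφ, hψL]
    constructor
    · intro hw i
      refine Fin.cases (fun h => absurd rfl h) (fun i => ?_) i
      refine Fin.cases (fun _ h => absurd rfl h) (fun i _ _ => ?_) i
      exact hw i
    · intro hw i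
      exact hw i.succ.succ (Fin.succ_ne_zero _)
        (fun h => Fin.succ_ne_zero i (Fin.succ_injective _ h))
  · intro P hP
    rw [hφ]
    exact hl (some ⟨P, hP⟩)

end Frames

/-! ### The Hilbert function as the rank of evaluation. -/

section HilbertFunction

variable {K : Type*} [Field K] {n : ℕ}

lemma eval_smul_of_isHomogeneous {σ : Type*} [Fintype σ] {i : ℕ} {f : MvPolynomial σ K}
    (hf : f.IsHomogeneous i) (t : K) (w : σ → K) : eval (t • w) f = t ^ i * eval w f := by
  rw [eval_eq', eval_eq', Finset.mul_sum]
  refine Finset.sum_congr rfl fun d hd => ?_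
  have hdeg : ∑ j, d j = i := by
    rw [← Finsupp.degree_eq_sum]
    by_contra h
    exact MvPolynomial.mem_support_iff.1 hd (hf.coeff_eq_zero h)
  simp only [Pi.smul_apply, smul_eq_mul, mul_pow, Finset.prod_mul_distrib,
    Finset.prod_pow_eq_pow_sum, hdeg]
  ring

/-- The space of forms of degree `i` in `K[x₀, …, xₙ]`. -/
abbrev Forms (K : Type*) [Field K] (n i : ℕ) : Submodule K (MvPolynomial (Fin (n + 1)) K) :=
  homogeneousSubmodule (Fin (n + 1)) K i

instance finiteDimensional_forms (i : ℕ) : FiniteDimensional K (Forms K n i) :=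
  Module.Finite.iff_fg.2 (homogeneousSubmodule_fg _ _ i)

lemma finrank_forms (i : ℕ) : finrank K (Forms K n i) = (i + n).choose n := by
  have hset : {d : Fin (n + 1) →₀ ℕ | d.degree = i} =
      ((Finset.univ : Finset (Fin (n + 1))).finsuppAntidiag i : Set (Fin (n + 1) →₀ ℕ)) := by
    ext d
    simp [Finset.mem_finsuppAntidiag, Finsupp.degree_eq_sum]
  have h1 := (homogeneousSubmodule_eq_finsupp_supported (Fin (n + 1)) K i)
  rw [hset] at h1
  rw [Forms, h1, LinearEquiv.finrank_eq (AddMonoidAlgebra.supportedEquivFinsupp _),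
    Module.finrank_finsupp_self]
  simp only [Finset.coe_sort_coe, Fintype.card_coe, Finset.card_finsuppAntidiag_nat_eq_choose]
  rw [Finset.card_univ, Fintype.card_fin, show n + 1 + i - 1 = i + n by omega]
  exact Nat.choose_symm_add

/-- Evaluation of forms at the (chosen representatives of the) points of `Γ`. -/
def evalOn (Γ : Set (ℙ K (Fin (n + 1) → K))) (i : ℕ) : Forms K n i →ₗ[K] (Γ → K) where
  toFun f P := eval P.1.rep f.1
  map_add' f g := by ext P; simp
  map_smul' c f := by ext P; simp [smul_eval]

lemma mem_ker_evalOn {Γ : Set (ℙ K (Fin (n + 1) → K))} {i : ℕ} {f : Forms K n i} :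
    f ∈ LinearMap.ker (evalOn Γ i) ↔ ∀ P ∈ Γ, eval P.rep f.1 = 0 := by
  rw [LinearMap.mem_ker, _root_.funext_iff]
  exact ⟨fun h P hP => h ⟨P, hP⟩, fun h P => h P.1 P.2⟩

lemma hilbertFunction_add_finrank_ker (Γ : Set (ℙ K (Fin (n + 1) → K))) (i : ℕ) :
    hilbertFunction (idealOf Γ) i + finrank K (LinearMap.ker (evalOn Γ i)) =
      (i + n).choose n := by
  let g := (Ideal.Quotient.mkₐ K (idealOf Γ)).toLinearMap.domRestrict (Forms K n i)
  have hker : LinearMap.ker g = LinearMap.ker (evalOn Γ i) := by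
    ext f
    rw [mem_ker_evalOn, ← mem_idealOf_iff_of_isHomogeneous f.2, LinearMap.mem_ker]
    exact Ideal.Quotient.eq_zero_iff_mem
  have hr : LinearMap.range g = (homogeneousSubmodule (Fin (n + 1)) K i).map
      (Ideal.Quotient.mkₐ K (idealOf Γ)).toLinearMap := LinearMap.range_domRestrict _ _
  rw [hilbertFunction, ← hr, ← hker, LinearMap.finrank_range_add_finrank_ker, finrank_forms]

lemma hilbertFunction_eq_finrank_range (Γ : Set (ℙ K (Fin (n + 1) → K))) (i : ℕ) :
    hilbertFunction (idealOf Γ) i = finrank K (LinearMap.range (evalOn Γ i)) := by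
  have h1 := hilbertFunction_add_finrank_ker Γ i
  have h2 := LinearMap.finrank_range_add_finrank_ker (evalOn Γ i)
  rw [finrank_forms] at h2
  omega

lemma hilbertFunction_le_ncard {Γ : Set (ℙ K (Fin (n + 1) → K))} (hΓ : Γ.Finite) (i : ℕ) :
    hilbertFunction (idealOf Γ) i ≤ Γ.ncard := by
  have := hΓ.fintype
  rw [hilbertFunction_eq_finrank_range]
  refine (Submodule.finrank_le _).trans ?_
  rw [finrank_pi, ← Nat.card_coe_set_eq, Nat.card_eq_fintype_card]

/-- If the points of `Γ` impose independent conditions on forms of degree `i`, then such forms take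
arbitrary values on `Γ`. -/
lemma exists_form_eval_eq {Γ : Set (ℙ K (Fin (n + 1) → K))} (hΓ : Γ.Finite) {i : ℕ}
    (h : hilbertFunction (idealOf Γ) i = Γ.ncard) (g : ℙ K (Fin (n + 1) → K) → K) :
    ∃ f : MvPolynomial (Fin (n + 1)) K, f.IsHomogeneous i ∧ ∀ P ∈ Γ, eval P.rep f = g P := by
  have := hΓ.fintype
  have htop : LinearMap.range (evalOn Γ i) = ⊤ := by
    refine Submodule.eq_top_of_finrank_eq ?_
    rw [← hilbertFunction_eq_finrank_range, h, finrank_pi, ← Nat.card_coe_set_eq,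
      Nat.card_eq_fintype_card]
  obtain ⟨f, hf⟩ := LinearMap.range_eq_top.1 htop fun P => g P.1
  exact ⟨f.1, f.2, fun P hP => congrFun hf ⟨P, hP⟩⟩

variable (φ : Basis (Fin (n + 1)) K (Dual K (Fin (n + 1) → K)))

/-- The forms of degree `i` divisible by the linear form `φ j`. -/
def divisibleForms (j : Fin (n + 1)) (i : ℕ) : Submodule K (Forms K n i) :=
  ((formIdeal φ {j}).restrictScalars K).comap (Forms K n i).subtype

lemma mem_divisibleForms {j : Fin (n + 1)} {i : ℕ} {f : Forms K n i} :
    f ∈ divisibleForms φ j i ↔ f.1 ∈ formIdeal φ {j} := Iff.rfl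

lemma mem_formIdeal_singleton {j : Fin (n + 1)} {f : MvPolynomial (Fin (n + 1)) K} :
    f ∈ formIdeal φ {j} ↔ ∃ g, f = linForm (φ j) * g := by
  rw [formIdeal_singleton, Ideal.mem_span_singleton]
  rfl

lemma linForm_ne_zero (j : Fin (n + 1)) : linForm (φ j) ≠ 0 := by
  intro h
  obtain ⟨w, hw⟩ := exists_forall_apply_eq φ 1
  have h1 := eval_linForm (φ j) w
  rw [h, hw] at h1
  simp at h1

/-- Multiplication by φⱼ identifies the divisible forms with all forms of degree i - 1, and the
count is Pascal's rule. In degree 0 only the zero form is divisible. -/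
lemma finrank_divisibleForms (hn : 1 ≤ n) (j : Fin (n + 1)) (i : ℕ) :
    finrank K (divisibleForms φ j i) + (i + (n - 1)).choose (n - 1) = (i + n).choose n := by
  obtain ⟨m, rfl⟩ : ∃ m, n = m + 1 := ⟨n - 1, by omega⟩
  cases i with
  | zero =>
    have : divisibleForms φ j 0 = ⊥ := by
      rw [eq_bot_iff]
      intro f hf
      obtain ⟨g, hg⟩ := (mem_formIdeal_singleton φ).1 ((mem_divisibleForms φ).1 hf)
      have h1 := intComponent_of_isHomogeneous f.2 0
      rw [hg, intComponent_mul_left (isHomogeneous_linForm _), intComponent_of_neg (by simp),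
        mul_zero, if_pos (by simp), ← hg] at h1
      exact Subtype.ext h1.symm
    rw [this, finrank_bot]
    simp
  | succ i =>
    let μ : Forms K (m + 1) i →ₗ[K] Forms K (m + 1) (i + 1) :=
      LinearMap.codRestrict _ ((LinearMap.mulLeft K (linForm (φ j))).domRestrict _) fun f => by
        have := (isHomogeneous_linForm (φ j)).mul f.2
        rwa [add_comm 1 i] at this
    have hμ : Function.Injective μ := fun f g h =>
      Subtype.ext (mul_left_cancel₀ (linForm_ne_zero φ j) (congrArg Subtype.val h))
    have hr : LinearMap.range μ = divisibleForms φ j (i + 1) := by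
      ext f
      rw [mem_divisibleForms, mem_formIdeal_singleton]
      constructor
      · rintro ⟨g, rfl⟩
        exact ⟨g.1, rfl⟩
      · rintro ⟨g, hg⟩
        have h1 := intComponent_of_isHomogeneous f.2 (i + 1 : ℕ)
        rw [if_pos rfl] at h1
        refine ⟨⟨intComponent i g, isHomogeneous_intComponent _ _⟩, Subtype.ext ?_⟩
        change linForm (φ j) * intComponent i g = f.1
        rw [← h1, hg, intComponent_mul_left (isHomogeneous_linForm _)]
        congr 3
        simp
    rw [← hr, LinearMap.finrank_range_of_inj hμ, finrank_forms, Nat.add_sub_cancel,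
      show i + 1 + (m + 1) = (i + (m + 1)) + 1 by omega, Nat.choose_succ_succ' (i + (m + 1)) m,
      show i + 1 + m = i + (m + 1) by omega, add_comm]

variable {φ}

lemma divisibleForms_le_ker {j : Fin (n + 1)} {Γ : Set (ℙ K (Fin (n + 1) → K))}
    (hΓ : ∀ P ∈ Γ, φ j P.rep = 0) (i : ℕ) :
    divisibleForms φ j i ≤ LinearMap.ker (evalOn Γ i) := fun _ hf =>
  mem_ker_evalOn.2 fun P hP => eval_eq_zero_of_mem_formIdeal φ hf fun _ hk => hk ▸ hΓ P hP

lemma hilbertFunction_le_choose (hn : 1 ≤ n) {j : Fin (n + 1)}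
    {Γ : Set (ℙ K (Fin (n + 1) → K))} (hΓ : ∀ P ∈ Γ, φ j P.rep = 0) (i : ℕ) :
    hilbertFunction (idealOf Γ) i ≤ (i + (n - 1)).choose (n - 1) := by
  have h1 := hilbertFunction_add_finrank_ker Γ i
  have h2 := finrank_divisibleForms φ hn j i
  have h3 := Submodule.finrank_mono (divisibleForms_le_ker hΓ i)
  omega

/-- If the Hilbert function of points of a hyperplane is that of the hyperplane in degree `i`, then
the forms of degree `i` vanishing at the points are divisible by the equation of the hyperplane. -/
lemma mem_formIdeal_of_hilbertFunction_eq (hn : 1 ≤ n) {j : Fin (n + 1)}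
    {Γ : Set (ℙ K (Fin (n + 1) → K))} (hΓ : ∀ P ∈ Γ, φ j P.rep = 0) {i : ℕ}
    (h : hilbertFunction (idealOf Γ) i = (i + (n - 1)).choose (n - 1))
    {f : MvPolynomial (Fin (n + 1)) K} (hf : f.IsHomogeneous i)
    (hfΓ : ∀ P ∈ Γ, eval P.rep f = 0) : f ∈ formIdeal φ {j} := by
  have h1 := hilbertFunction_add_finrank_ker Γ i
  have h2 := finrank_divisibleForms φ hn j i
  have h3 := Submodule.eq_of_le_of_finrank_eq (divisibleForms_le_ker hΓ i) (by omega)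
  have h4 : (⟨f, hf⟩ : Forms K n i) ∈ divisibleForms φ j i := by
    rw [h3]
    exact mem_ker_evalOn.2 hfΓ
  exact h4

/-- Lower bound for the Hilbert function by a nonzero evaluation determinant. -/
lemma le_hilbertFunction_of_det_ne_zero {Γ : Set (ℙ K (Fin (n + 1) → K))} {i k : ℕ}
    {f : Fin k → MvPolynomial (Fin (n + 1)) K} (hf : ∀ j, (f j).IsHomogeneous i)
    {w : Fin k → Fin (n + 1) → K} (hw : ∀ j, ∃ P ∈ Γ, ∃ c : K, w j = c • P.rep)
    (hdet : (Matrix.of fun a b => eval (w a) (f b)).det ≠ 0) :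
    k ≤ hilbertFunction (idealOf Γ) i := by
  have hli : LinearIndependent K
      fun b => (⟨evalOn Γ i ⟨f b, hf b⟩, LinearMap.mem_range_self _ _⟩ :
        LinearMap.range (evalOn Γ i)) := by
    rw [Fintype.linearIndependent_iff]
    intro c hc
    have h0 : ∀ P ∈ Γ, ∑ b, c b * eval P.rep (f b) = 0 := by
      intro P hP
      have h1 := congrFun (congrArg Subtype.val hc) ⟨P, hP⟩
      rw [Submodule.coe_sum, Finset.sum_apply] at h1
      exact h1
    have hM : (Matrix.of fun a b => eval (w a) (f b)).mulVec c = 0 := by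
      ext1 a
      obtain ⟨P, hP, t, ht⟩ := hw a
      have hev : ∀ b, eval (w a) (f b) = t ^ i * eval P.rep (f b) := by
        intro b
        rw [ht, eval_smul_of_isHomogeneous (hf b)]
      have := h0 P hP
      simp only [Matrix.mulVec, dotProduct, Matrix.of_apply, hev, Pi.zero_apply]
      calc ∑ b, t ^ i * eval P.rep (f b) * c b = t ^ i * ∑ b, c b * eval P.rep (f b) := by
            rw [Finset.mul_sum]
            exact Finset.sum_congr rfl fun b _ => by ring
        _ = 0 := by rw [this, mul_zero]
    exact fun b => congrFun (Matrix.eq_zero_of_mulVec_eq_zero hdet hM) b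
  rw [hilbertFunction_eq_finrank_range]
  simpa using hli.fintype_card_le_finrank

end HilbertFunction

variable {K : Type*} [Field K] {n : ℕ}

/-! ### Counting points in hyperplanes. -/

section Hyp

lemma submodule_le_iff_rep_mem {P : ℙ K (Fin (n + 1) → K)}
    {H : Submodule K (Fin (n + 1) → K)} : P.submodule ≤ H ↔ P.rep ∈ H := by
  rw [P.submodule_eq, Submodule.span_singleton_le_iff_mem]

lemma eq_of_rep_eq_smul {P Q : ℙ K (Fin (n + 1) → K)} {c : K} (h : P.rep = c • Q.rep) :
    P = Q := by
  rw [← P.mk_rep, ← Q.mk_rep, Projectivization.mk_eq_mk_iff']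
  exact ⟨c, h.symm⟩

lemma le_hyp {Γ : Set (ℙ K (Fin (n + 1) → K))} (hΓ : Γ.Finite)
    {H : Submodule K (Fin (n + 1) → K)} (hH : finrank K H = n) :
    {P | P ∈ Γ ∧ P.submodule ≤ H}.ncard ≤ hyp Γ :=
  le_csSup ⟨Γ.ncard, by
    rintro _ ⟨H', _, rfl⟩
    exact Set.ncard_le_ncard (fun P hP => hP.1) hΓ⟩ ⟨H, hH, rfl⟩

lemma hyp_le {Γ : Set (ℙ K (Fin (n + 1) → K))} {m : ℕ}
    (h : ∀ H : Submodule K (Fin (n + 1) → K), finrank K H = n →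
      {P | P ∈ Γ ∧ P.submodule ≤ H}.ncard ≤ m) : hyp Γ ≤ m :=
  csSup_le' (by rintro _ ⟨H, hH, rfl⟩; exact h H hH)

end Hyp

/-! ### Many points in the hyperplane: the minimum distance is a least socle degree. -/

/-- The indices of the equations of the line `φ i = 0`, `i ≠ 0, 1`. -/
def lineIdx (n : ℕ) : Set (Fin (n + 1)) := {i | i ≠ 0 ∧ i ≠ 1}

lemma eq_of_forall_basis_apply_eq (φ : Basis (Fin (n + 1)) K (Dual K (Fin (n + 1) → K)))
    {v w : Fin (n + 1) → K} (h : ∀ i, φ i v = φ i w) : v = w := by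
  rw [← sub_eq_zero, ← forall_dual_apply_eq_zero_iff K]
  intro ψ
  rw [← φ.sum_repr ψ, LinearMap.sum_apply]
  exact Finset.sum_eq_zero fun i _ => by
    rw [LinearMap.smul_apply, map_sub, h i, sub_self, smul_zero]

/-- Points `Γ₁` in the hyperplane `φ 1 = 0` and points `Γ₂` off this hyperplane on the line
`φ i = 0`, `i ≠ 0, 1`, such that `φ 0` vanishes at none of the points. -/
structure Configuration (φ : Basis (Fin (n + 1)) K (Dual K (Fin (n + 1) → K)))
    (Γ₁ Γ₂ : Set (ℙ K (Fin (n + 1) → K))) : Prop where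
  two_le : 2 ≤ n
  finite_left : Γ₁.Finite
  finite_right : Γ₂.Finite
  hyperplane : ∀ P ∈ Γ₁, φ 1 P.rep = 0
  line : ∀ P ∈ Γ₂, ∀ i ∈ lineIdx n, φ i P.rep = 0
  off_hyperplane : ∀ P ∈ Γ₂, φ 1 P.rep ≠ 0
  nonvanishing : ∀ P ∈ Γ₁ ∪ Γ₂, φ 0 P.rep ≠ 0

namespace Configuration

variable {φ : Basis (Fin (n + 1)) K (Dual K (Fin (n + 1) → K))}
  {Γ₁ Γ₂ : Set (ℙ K (Fin (n + 1) → K))} (hc : Configuration φ Γ₁ Γ₂)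
include hc

lemma one_ne_zero : (1 : Fin (n + 1)) ≠ 0 := by
  have := hc.two_le
  rw [Ne, Fin.ext_iff, Fin.val_one', Fin.val_zero, Nat.mod_eq_of_lt (by omega)]
  omega

lemma exists_mem_lineIdx : ∃ i, i ∈ lineIdx n := by
  have := hc.two_le
  refine ⟨⟨2, by omega⟩, ?_, ?_⟩
  · rw [Ne, Fin.ext_iff]
    simp
  · rw [Ne, Fin.ext_iff, Fin.val_one', Nat.mod_eq_of_lt (by omega)]
    simp

lemma disjoint : Disjoint Γ₁ Γ₂ :=
  Set.disjoint_left.2 fun P h1 h2 => hc.off_hyperplane P h2 (hc.hyperplane P h1)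

lemma finite_union : (Γ₁ ∪ Γ₂).Finite := hc.finite_left.union hc.finite_right

lemma ncard_union : (Γ₁ ∪ Γ₂).ncard = Γ₁.ncard + Γ₂.ncard :=
  Set.ncard_union_eq hc.disjoint hc.finite_left hc.finite_right

/-- A form of degree less than `|Γ₂|` vanishing on `Γ₂` vanishes on the line. -/
lemma mem_formIdeal_lineIdx [Infinite K] {k : ℕ} (hk : k < Γ₂.ncard)
    {f : MvPolynomial (Fin (n + 1)) K} (hf : f.IsHomogeneous k)
    (hfΓ : ∀ P ∈ Γ₂, eval P.rep f = 0) : f ∈ formIdeal φ (lineIdx n) := by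
  obtain ⟨q, hq⟩ := exists_forall_apply_eq φ (Pi.single 0 1)
  obtain ⟨e, he⟩ := exists_forall_apply_eq φ (Pi.single 1 1)
  have h10 := hc.one_ne_zero
  have hrep : ∀ w, (∀ i ∈ lineIdx n, φ i w = 0) → w = φ 0 w • q + φ 1 w • e := by
    intro w hw
    refine eq_of_forall_basis_apply_eq φ fun i => ?_
    rw [map_add, map_smul, map_smul, hq, he, smul_eq_mul, smul_eq_mul]
    by_cases h0 : i = 0
    · subst h0
      simp [h10.symm]
    by_cases h1 : i = 1
    · subst h1
      simp [h10]
    · rw [hw i ⟨h0, h1⟩]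
      simp [h0, h1]
  have hrep' : ∀ w, (∀ i ∈ lineIdx n, φ i w = 0) → φ 0 w ≠ 0 →
      w = φ 0 w • (q + (φ 1 w / φ 0 w) • e) := by
    intro w hw h0
    rw [smul_add, smul_smul, mul_div_cancel₀ _ h0]
    exact hrep w hw
  have heval : ∀ w, (∀ i ∈ lineIdx n, φ i w = 0) → φ 0 w ≠ 0 →
      eval w f = φ 0 w ^ k * eval (q + (φ 1 w / φ 0 w) • e) f := by
    intro w hw h0
    conv_lhs => rw [hrep' w hw h0]
    exact eval_smul_of_isHomogeneous hf _ _
  -- The restriction of `f` to the chart φ₀ = 1 of the line. The ratios φ₁/φ₀ at the points of Γ₂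
  -- are distinct roots, more of them than the degree allows.
  let g : Polynomial K :=
    aeval (fun i => Polynomial.C (q i) + Polynomial.X * Polynomial.C (e i)) f
  have hg : ∀ t, g.eval t = eval (q + t • e) f := by
    intro t
    have h : (Polynomial.evalRingHom t).comp (aeval (R := K) fun i =>
        Polynomial.C (q i) + Polynomial.X * Polynomial.C (e i)).toRingHom =
        eval (q + t • e) :=
      MvPolynomial.ringHom_ext (by simp) fun i => by simp [mul_comm t (e i)]
    exact congrArg (fun F => F f) h
  have hdeg : g.natDegree ≤ k := by
    have := aeval_natDegree_le f (m := k) (n := 1) hf.totalDegree_le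
      (fun i => Polynomial.C (q i) + Polynomial.X * Polynomial.C (e i)) (fun i => by
        compute_degree)
    rwa [mul_one] at this
  have := hc.finite_right.fintype
  have hg0 : g = 0 := by
    refine Polynomial.eq_zero_of_natDegree_lt_card_of_eval_eq_zero g
      (f := fun P : Γ₂ => φ 1 P.1.rep / φ 0 P.1.rep) ?_ ?_ ?_
    · intro P Q hPQ
      have hP0 := hc.nonvanishing P.1 (Or.inr P.2)
      have hQ0 := hc.nonvanishing Q.1 (Or.inr Q.2)
      refine Subtype.ext (eq_of_rep_eq_smul (c := φ 0 P.1.rep / φ 0 Q.1.rep) ?_)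
      have hQ : φ 0 P.1.rep • (q + (φ 1 Q.1.rep / φ 0 Q.1.rep) • e) =
          (φ 0 P.1.rep / φ 0 Q.1.rep) • Q.1.rep := by
        conv_rhs => rw [hrep' Q.1.rep (hc.line _ Q.2) hQ0, smul_smul]
        rw [← hrep' Q.1.rep (hc.line _ Q.2) hQ0, div_mul_cancel₀ _ hQ0]
      rw [← hQ, ← show φ 1 P.1.rep / φ 0 P.1.rep = φ 1 Q.1.rep / φ 0 Q.1.rep from hPQ]
      exact hrep' P.1.rep (hc.line _ P.2) hP0
    · intro P
      have hP0 := hc.nonvanishing P.1 (Or.inr P.2)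
      have h1 := heval P.1.rep (hc.line _ P.2) hP0
      rw [hfΓ P.1 P.2] at h1
      rw [hg]
      exact (mul_eq_zero.1 h1.symm).resolve_left (pow_ne_zero _ hP0)
    · rw [← Nat.card_eq_fintype_card, Nat.card_coe_set_eq]
      omega
  -- The factor φ₀ takes care of the one point of the line outside the chart.
  refine mem_formIdeal_of_mul_mem φ (i := 0) (fun h => h.1 rfl)
    (mem_formIdeal_of_forall_eval_eq_zero φ fun w hw => ?_)
  rw [map_mul, eval_linForm]
  by_cases h0 : φ 0 w = 0
  · rw [h0, zero_mul]
  · rw [heval w hw h0, ← hg, hg0, Polynomial.eval_zero, mul_zero, mul_zero]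

lemma mul_mem_idealOf {t : MvPolynomial (Fin (n + 1)) K} (ht : t ∈ formIdeal φ (lineIdx n)) :
    linForm (φ 1) * t ∈ idealOf (Γ₁ ∪ Γ₂) := by
  refine mem_of_forall_homogeneousComponent_mem fun i => ?_
  rw [← intComponent_natCast, intComponent_mul_left (isHomogeneous_linForm _)]
  refine (mem_idealOf_iff_of_isHomogeneous
    ((isHomogeneous_linForm _).mul (isHomogeneous_intComponent _ _))).2 ?_
  rintro P (hP | hP)
  · rw [map_mul, eval_linForm, hc.hyperplane P hP, zero_mul]
  · rw [map_mul, eval_eq_zero_of_mem_formIdeal φ (isGradedIdeal_formIdeal φ _ _ ht _)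
      (hc.line P hP), mul_zero]

/-- If forms of degree `k ≤ |Γ₂|` vanishing on `Γ₁` vanish on the hyperplane, then forms of degree
`k` vanishing on `Γ₁ ∪ Γ₂` vanish on the union of the hyperplane and the line. -/
lemma exists_eq_mul_of_mem_idealOf [Infinite K] (h0 : 1 ≤ Γ₂.ncard) {k : ℕ}
    (hk : k ≤ Γ₂.ncard)
    (hgen : ∀ f : MvPolynomial (Fin (n + 1)) K, f.IsHomogeneous k →
      (∀ P ∈ Γ₁, eval P.rep f = 0) → f ∈ formIdeal φ {1})
    {f : MvPolynomial (Fin (n + 1)) K} (hf : f.IsHomogeneous k)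
    (hfI : f ∈ idealOf (Γ₁ ∪ Γ₂)) :
    ∃ t ∈ formIdeal φ (lineIdx n), f = linForm (φ 1) * t := by
  have hfΓ := eval_rep_eq_zero_of_mem_idealOf hfI
  obtain ⟨g, hg⟩ := (mem_formIdeal_singleton φ).1 (hgen f hf fun P hP => hfΓ P (Or.inl hP))
  have h1 := intComponent_of_isHomogeneous hf k
  rw [if_pos rfl, hg, intComponent_mul_left (isHomogeneous_linForm _), ← hg] at h1
  refine ⟨_, ?_, h1.symm⟩
  refine hc.mem_formIdeal_lineIdx (by omega) (isHomogeneous_intComponent _ _) fun P hP => ?_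
  have h2 := hfΓ P (Or.inr hP)
  rw [← h1, map_mul, eval_linForm] at h2
  exact (mul_eq_zero.1 h2).resolve_left (hc.off_hyperplane P hP)

lemma exists_eq_add_of_mem_sup [Infinite K] (h0 : 1 ≤ Γ₂.ncard) {k : ℕ}
    (hk : k ≤ Γ₂.ncard)
    (hgen : ∀ f : MvPolynomial (Fin (n + 1)) K, f.IsHomogeneous k →
      (∀ P ∈ Γ₁, eval P.rep f = 0) → f ∈ formIdeal φ {1})
    {f : MvPolynomial (Fin (n + 1)) K} (hf : f.IsHomogeneous k)
    (hfI : f ∈ idealOf (Γ₁ ∪ Γ₂) ⊔ Ideal.span {linForm (φ 0)}) :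
    ∃ t ∈ formIdeal φ (lineIdx n), ∃ b ∈ formIdeal φ {0}, f = linForm (φ 1) * t + b := by
  rw [← formIdeal_singleton] at hfI
  obtain ⟨a, ha, b, hb, hab⟩ := Submodule.mem_sup.1 hfI
  have h1 := intComponent_of_isHomogeneous hf k
  rw [if_pos rfl, ← hab, map_add, hab] at h1
  obtain ⟨t, ht, hat⟩ := hc.exists_eq_mul_of_mem_idealOf h0 hk hgen
    (isHomogeneous_intComponent (k : ℤ) a) (isGradedIdeal_idealOf _ _ ha _)
  exact ⟨t, ht, _, isGradedIdeal_formIdeal φ _ _ hb k, by rw [← hat, h1]⟩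

/-- In degree k + 1 ≤ β the ideal is φ₁T. Modulo φ₀, cancelling φ₁ in φ₁f gives f ∈ T, and
cancelling an equation φⱼ of the line in φⱼf gives f ∈ (φ₁). Since T ∩ (φ₁) = φ₁T there, f lies in
the ideal. -/
lemma mem_sup_of_socle [Infinite K] (h0 : 1 ≤ Γ₂.ncard) {k : ℕ} (hk : k < Γ₂.ncard)
    (hgen : ∀ f : MvPolynomial (Fin (n + 1)) K, f.IsHomogeneous (k + 1) →
      (∀ P ∈ Γ₁, eval P.rep f = 0) → f ∈ formIdeal φ {1})
    {f : MvPolynomial (Fin (n + 1)) K} (hf : f.IsHomogeneous k)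
    (hsoc : ∀ i, linForm (φ i) * f ∈ idealOf (Γ₁ ∪ Γ₂) ⊔ Ideal.span {linForm (φ 0)}) :
    f ∈ idealOf (Γ₁ ∪ Γ₂) ⊔ Ideal.span {linForm (φ 0)} := by
  have h10 := hc.one_ne_zero
  have hhom : ∀ i, (linForm (φ i) * f).IsHomogeneous (k + 1) := fun i => by
    rw [add_comm k 1]
    exact (isHomogeneous_linForm _).mul hf
  obtain ⟨a, ha, b, hb, hab⟩ := hc.exists_eq_add_of_mem_sup h0 hk hgen (hhom 1) (hsoc 1)
  have hfa : f - a ∈ formIdeal φ {0} :=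
    mem_formIdeal_of_mul_mem φ (i := 1) h10 (by rw [mul_sub, hab, add_sub_cancel_left]; exact hb)
  obtain ⟨j, hj⟩ := hc.exists_mem_lineIdx
  obtain ⟨a', -, b', hb', hab'⟩ := hc.exists_eq_add_of_mem_sup h0 hk hgen (hhom j) (hsoc j)
  have hf1 : f ∈ formIdeal φ (insert 1 {0}) := by
    refine mem_formIdeal_of_mul_mem φ (i := j) (by simp [hj.1, hj.2]) ?_
    rw [hab']
    exact add_mem (Ideal.mul_mem_right _ _ (linForm_mem_formIdeal φ (Set.mem_insert _ _)))
      (formIdeal_mono φ (Set.subset_insert _ _) hb')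
  obtain ⟨v, c, hcm, hvc⟩ := (mem_formIdeal_insert φ).1 hf1
  -- Here φ₁v ∈ (φ₀) + T, and φ₁ is a nonzerodivisor modulo this ideal.
  have hv : v ∈ formIdeal φ (insert 0 (lineIdx n)) := by
    refine mem_formIdeal_of_mul_mem φ (i := 1) (by simp [h10, lineIdx]) ?_
    have : linForm (φ 1) * v = (f - a) + a - c := by
      rw [hvc]
      ring
    rw [this]
    have hle : formIdeal φ {0} ≤ formIdeal φ (insert 0 (lineIdx n)) :=
      formIdeal_mono φ (by simp)
    exact sub_mem (add_mem (hle hfa) (formIdeal_mono φ (Set.subset_insert _ _) ha)) (hle hcm)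
  obtain ⟨d, t, ht, hdt⟩ := (mem_formIdeal_insert φ).1 hv
  rw [formIdeal_singleton] at hcm
  have : f = linForm (φ 1) * t + (d * linForm (φ 1) * linForm (φ 0) + c) := by
    rw [hvc, hdt]
    ring
  rw [this]
  exact add_mem (Ideal.mem_sup_left (hc.mul_mem_idealOf ht)) (Ideal.mem_sup_right
    (add_mem (Ideal.mul_mem_left _ _ (Ideal.mem_span_singleton_self _)) hcm))

lemma mul_pow_mem_sup (h0 : 1 ≤ Γ₂.ncard) (i : Fin (n + 1)) :
    linForm (φ i) * linForm (φ 1) ^ Γ₂.ncard ∈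
      idealOf (Γ₁ ∪ Γ₂) ⊔ Ideal.span {linForm (φ 0)} := by
  by_cases hi0 : i = 0
  · subst hi0
    exact Ideal.mem_sup_right (Ideal.mul_mem_right _ _ (Ideal.mem_span_singleton_self _))
  by_cases hi1 : i = 1
  · subst hi1
    have := hc.finite_right.fintype
    -- Each factor vanishes at one point of Γ₂ and is congruent to φ₁ modulo φ₀. Thus φ₁G vanishes
    -- on Γ₁ ∪ Γ₂ and G ≡ φ₁^β.
    let G : MvPolynomial (Fin (n + 1)) K := ∏ P : Γ₂,
      (linForm (φ 1) - C (φ 1 P.1.rep / φ 0 P.1.rep) * linForm (φ 0))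
    have hG : linForm (φ 1) * G ∈ idealOf (Γ₁ ∪ Γ₂) := by
      have hGh : G.IsHomogeneous (∑ _P : Γ₂, 1) := IsHomogeneous.prod _ _ _ fun P _ =>
        (isHomogeneous_linForm _).sub ((isHomogeneous_linForm _).C_mul _)
      refine (mem_idealOf_iff_of_isHomogeneous ((isHomogeneous_linForm _).mul hGh)).2 ?_
      rintro P (hP | hP)
      · rw [map_mul, eval_linForm, hc.hyperplane P hP, zero_mul]
      · rw [map_mul, map_prod, Finset.prod_eq_zero (Finset.mem_univ (⟨P, hP⟩ : Γ₂)), mul_zero]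
        simp only [map_sub, map_mul, eval_C, eval_linForm]
        rw [div_mul_cancel₀ _ (hc.nonvanishing P (Or.inr hP)), sub_self]
    have hGl : linForm (φ 1) ^ Γ₂.ncard - G ∈ Ideal.span {linForm (φ 0)} := by
      have hl : Ideal.Quotient.mk (Ideal.span {linForm (φ 0)}) (linForm (φ 0)) = 0 :=
        Ideal.Quotient.eq_zero_iff_mem.2 (Ideal.mem_span_singleton_self _)
      rw [← Ideal.Quotient.eq_zero_iff_mem, map_sub, map_pow, map_prod]
      simp only [map_sub, map_mul, hl, mul_zero, sub_zero]
      rw [Finset.prod_const, Finset.card_univ, ← Nat.card_eq_fintype_card,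
        Nat.card_coe_set_eq, sub_self]
    have : linForm (φ 1) * linForm (φ 1) ^ Γ₂.ncard =
        linForm (φ 1) * G + linForm (φ 1) * (linForm (φ 1) ^ Γ₂.ncard - G) := by
      ring
    rw [this]
    exact add_mem (Ideal.mem_sup_left hG) (Ideal.mem_sup_right (Ideal.mul_mem_left _ _ hGl))
  · obtain ⟨k, hk⟩ : ∃ k, Γ₂.ncard = k + 1 := ⟨Γ₂.ncard - 1, by omega⟩
    rw [hk, pow_succ', mul_left_comm]
    refine Ideal.mem_sup_left ?_
    exact hc.mul_mem_idealOf (Ideal.mul_mem_right _ _ (linForm_mem_formIdeal φ ⟨hi0, hi1⟩))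

/-- Elements of degree β of the ideal have the form φ₁t + b with t ∈ T and b ∈ (φ₀). They vanish at
the vector e where φ₁ is 1 and the other coordinates are 0, while φ₁^β does not. -/
lemma pow_notMem_sup [Infinite K] (h0 : 1 ≤ Γ₂.ncard)
    (hgen : ∀ f : MvPolynomial (Fin (n + 1)) K, f.IsHomogeneous Γ₂.ncard →
      (∀ P ∈ Γ₁, eval P.rep f = 0) → f ∈ formIdeal φ {1}) :
    linForm (φ 1) ^ Γ₂.ncard ∉ idealOf (Γ₁ ∪ Γ₂) ⊔ Ideal.span {linForm (φ 0)} := by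
  intro hmem
  have hhom : (linForm (φ 1) ^ Γ₂.ncard).IsHomogeneous Γ₂.ncard := by
    simpa using (isHomogeneous_linForm (φ 1)).pow Γ₂.ncard
  obtain ⟨t, ht, b, hb, h⟩ := hc.exists_eq_add_of_mem_sup h0 le_rfl hgen hhom hmem
  obtain ⟨e, he⟩ := exists_forall_apply_eq φ (Pi.single 1 1)
  have h1 := congrArg (eval e) h
  rw [map_add, map_mul, map_pow, eval_linForm, he, Pi.single_eq_same, one_pow,
    eval_eq_zero_of_mem_formIdeal φ ht fun i hi => by rw [he, Pi.single_eq_of_ne hi.2],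
    eval_eq_zero_of_mem_formIdeal φ hb fun i hi => by
      rw [he, Pi.single_eq_of_ne (by rw [show i = 0 from hi]; exact hc.one_ne_zero.symm)],
    mul_zero, add_zero] at h1
  exact _root_.one_ne_zero h1

/-- If forms of degree at most `|Γ₂|` vanishing on `Γ₁` vanish on the hyperplane, then no hyperplane
contains more than `|Γ₁|` points. -/
lemma hyp_le_ncard [Infinite K]
    (hgen : ∀ k ≤ Γ₂.ncard, ∀ f : MvPolynomial (Fin (n + 1)) K, f.IsHomogeneous k →
      (∀ P ∈ Γ₁, eval P.rep f = 0) → f ∈ formIdeal φ {1}) :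
    hyp (Γ₁ ∪ Γ₂) ≤ Γ₁.ncard := by
  refine hyp_le fun H' hH' => ?_
  obtain ⟨h', hh'⟩ := exists_dual_mem_iff_apply_eq_zero hH'
  simp only [submodule_le_iff_rep_mem, hh']
  by_cases hH : ∀ w, φ 1 w = 0 → h' w = 0
  · refine Set.ncard_le_ncard ?_ hc.finite_left
    rintro P ⟨hP | hP, hP'⟩
    · exact hP
    · exfalso
      have h1 : LinearMap.ker (φ 1) ≤ LinearMap.ker h' := fun w hw => hH w hw
      have h2 : LinearMap.ker (φ 1) = LinearMap.ker h' := by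
        refine Submodule.eq_of_le_of_finrank_eq h1 ?_
        have e1 := Dual.finrank_ker_add_one_of_ne_zero (φ.ne_zero 1)
        have e2 : LinearMap.ker h' = H' := by
          ext w
          exact (hh' w).symm
        rw [e2, hH']
        simpa using e1
      exact hc.off_hyperplane P hP (LinearMap.mem_ker.1 (h2 ▸ hP'))
  push Not at hH
  set A : Set (ℙ K (Fin (n + 1) → K)) := {P | P ∈ Γ₁ ∧ h' P.rep ≠ 0} with hA
  have hAf : A.Finite := hc.finite_left.subset fun P hP => hP.1
  have hcover : {P | P ∈ Γ₁ ∪ Γ₂ ∧ h' P.rep = 0} ⊆ (Γ₁ \ A) ∪ Γ₂ := by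
    rintro P ⟨hP | hP, hP'⟩
    · exact Or.inl ⟨hP, fun h => h.2 hP'⟩
    · exact Or.inr hP
  have hcard := (Set.ncard_le_ncard hcover
    ((hc.finite_left.subset Set.sdiff_subset).union hc.finite_right)).trans
      (Set.ncard_union_le _ _)
  have hdiff := Set.ncard_sdiff_add_ncard_of_subset (s := A) (t := Γ₁) (fun P hP => hP.1)
    hc.finite_left
  -- `H'` misses the points `A` of Γ₁ and gains at most all of Γ₂.
  suffices Γ₂.ncard ≤ A.ncard by omega
  by_contra! hlt
  have := hAf.fintype
  -- The hyperplane has vector space dimension n ≥ 2, so one point does not span it.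
  have hsep : ∀ P : A, ∃ ψ : Dual K (Fin (n + 1) → K), ψ P.1.rep = 0 ∧
      ∃ w ∈ LinearMap.ker (φ 1), ψ w ≠ 0 := by
    intro P
    obtain ⟨w, hw, hwP⟩ : ∃ w ∈ LinearMap.ker (φ 1), w ∉ Submodule.span K {P.1.rep} := by
      by_contra! hle
      have e1 := Dual.finrank_ker_add_one_of_ne_zero (φ.ne_zero 1)
      have e2 := Submodule.finrank_mono (show LinearMap.ker (φ 1) ≤ _ from hle)
      have e3 := finrank_span_singleton (K := K) P.1.rep_nonzero
      have := hc.two_le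
      rw [e3] at e2
      simp at e1
      omega
    obtain ⟨ψ, hψ, hle⟩ := Submodule.exists_le_ker_of_notMem hwP
    exact ⟨ψ, hle (Submodule.mem_span_singleton_self _), w, hw, hψ⟩
  choose ψ hψ hψ' using hsep
  obtain ⟨w, hw, hwne⟩ := Module.Dual.exists_forall_mem_ne_zero_of_forall_exists
    (LinearMap.ker (φ 1)) (fun o : Option A => o.elim h' ψ) (by
      rintro (_ | P)
      · exact hH
      · exact hψ' P)
  -- This form vanishes on Γ₁ and has degree 1 + |A| ≤ β, so it should be divisible by φ₁; but at
  -- `w` in the hyperplane all its factors are nonzero.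
  let f : MvPolynomial (Fin (n + 1)) K := linForm h' * ∏ P : A, linForm (ψ P)
  have hf : f.IsHomogeneous (1 + ∑ _P : A, 1) := (isHomogeneous_linForm _).mul
    (IsHomogeneous.prod _ _ _ fun P _ => isHomogeneous_linForm _)
  have hfmem := hgen _ (by
    rw [Finset.sum_const, Finset.card_univ, ← Nat.card_eq_fintype_card, Nat.card_coe_set_eq,
      smul_eq_mul]
    omega) f hf (by
    intro P hP
    rw [map_mul, eval_linForm, map_prod]
    by_cases hP' : h' P.rep = 0
    · rw [hP', zero_mul]
    · rw [Finset.prod_eq_zero (Finset.mem_univ (⟨P, hP, hP'⟩ : A)), mul_zero]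
      rw [eval_linForm]
      exact hψ _)
  have h0 := eval_eq_zero_of_mem_formIdeal φ hfmem (w := w) fun i hi => by
    rw [show i = 1 from hi]
    exact hw
  rw [map_mul, map_prod, eval_linForm] at h0
  simp only [eval_linForm] at h0
  exact mul_ne_zero (hwne none) (Finset.prod_ne_zero_iff.2 fun P _ => hwne (some P)) h0

lemma ncard_le_hyp : Γ₁.ncard ≤ hyp (Γ₁ ∪ Γ₂) := by
  have e1 := Dual.finrank_ker_add_one_of_ne_zero (φ.ne_zero 1)
  refine le_trans ?_ (le_hyp hc.finite_union (H := LinearMap.ker (φ 1)) (by simpa using e1))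
  exact Set.ncard_le_ncard
    (fun P hP => ⟨Or.inl hP, submodule_le_iff_rep_mem.2 (hc.hyperplane P hP)⟩)
    (hc.finite_union.subset fun P hP => hP.1)

lemma minDist_eq (h : hyp (Γ₁ ∪ Γ₂) = Γ₁.ncard) : minDist (Γ₁ ∪ Γ₂) = Γ₂.ncard := by
  rw [minDist, h, hc.ncard_union, Nat.add_sub_cancel_left]

/-- For many generic points in the hyperplane, the minimum distance is the least socle degree. -/
lemma isLeast_socleDegrees [Infinite K] (h0 : 1 ≤ Γ₂.ncard)
    (hgen : IsGenericSet (n - 1) Γ₁)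
    (hcard : (Γ₂.ncard + (n - 1)).choose (n - 1) ≤ Γ₁.ncard) :
    IsLeast (socleDegrees (Γ₁ ∪ Γ₂)) (minDist (Γ₁ ∪ Γ₂) : ℤ) := by
  have hn := hc.two_le
  have hdiv : ∀ k ≤ Γ₂.ncard, ∀ f : MvPolynomial (Fin (n + 1)) K, f.IsHomogeneous k →
      (∀ P ∈ Γ₁, eval P.rep f = 0) → f ∈ formIdeal φ {1} := fun k hk f hf =>
    mem_formIdeal_of_hilbertFunction_eq (by omega) hc.hyperplane (by
      rw [hgen k, min_eq_left]
      exact (Nat.choose_le_choose _ (by omega)).trans hcard) hf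
  have hΓ : (Γ₁ ∪ Γ₂).Nonempty := by
    obtain ⟨P, hP⟩ := Set.nonempty_of_ncard_ne_zero (s := Γ₂) (by omega)
    exact ⟨P, Or.inr hP⟩
  rw [hc.minDist_eq (le_antisymm (hc.hyp_le_ncard hdiv) hc.ncard_le_hyp)]
  constructor
  · rw [mem_socleDegrees_iff_forms hΓ φ hc.nonvanishing]
    refine ⟨_, rfl, linForm (φ 1) ^ Γ₂.ncard, ?_, hc.mul_pow_mem_sup h0,
      hc.pow_notMem_sup h0 (hdiv _ le_rfl)⟩
    simpa using (isHomogeneous_linForm (φ 1)).pow Γ₂.ncard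
  · intro c hcs
    obtain ⟨k, rfl, f, hf, hsoc, hnot⟩ :=
      (mem_socleDegrees_iff_forms hΓ φ hc.nonvanishing).1 hcs
    by_contra hlt
    have hk : k < Γ₂.ncard := by omega
    exact hnot (hc.mem_sup_of_socle h0 hk (hdiv _ hk) hf hsoc)

end Configuration

/-! ### Few points in the hyperplane: a socle degree below the minimum distance. -/

namespace Configuration

variable {φ : Basis (Fin (n + 1)) K (Dual K (Fin (n + 1) → K))}
  {Γ₁ Γ₂ : Set (ℙ K (Fin (n + 1) → K))} (hc : Configuration φ Γ₁ Γ₂)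
include hc

/-- At most one point of the hyperplane lies on the line. -/
lemma exists_line_form_ne_zero (h2 : 2 ≤ Γ₁.ncard) :
    ∃ P ∈ Γ₁, ∃ i ∈ lineIdx n, φ i P.rep ≠ 0 := by
  by_contra! hall
  have hsub : Γ₁.ncard ≤ 1 := by
    rw [Set.ncard_le_one hc.finite_left]
    intro P hP Q hQ
    have hQ0 := hc.nonvanishing Q (Or.inl hQ)
    refine eq_of_rep_eq_smul (c := φ 0 P.rep / φ 0 Q.rep)
      (eq_of_forall_basis_apply_eq φ fun i => ?_)
    rw [map_smul, smul_eq_mul]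
    by_cases h0 : i = 0
    · subst h0
      rw [div_mul_cancel₀ _ hQ0]
    by_cases h1 : i = 1
    · subst h1
      rw [hc.hyperplane P hP, hc.hyperplane Q hQ, mul_zero]
    · rw [hall P hP i ⟨h0, h1⟩, hall Q hQ i ⟨h0, h1⟩, mul_zero]
  omega

/-- Some φᵢ with i ≥ 2 is nonzero at a point of Γ₁. If φᵢ = a + φ₀b with a ∈ I ∩ T, then b ∈ T has
no constant term, so φᵢ is the degree 1 part of a and vanishes at that point. -/
lemma exists_linForm_notMem [Infinite K] (h2 : 2 ≤ Γ₁.ncard) :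
    ∃ i ∈ lineIdx n, linForm (φ i) ∉
      (idealOf (Γ₁ ∪ Γ₂) ⊓ formIdeal φ (lineIdx n)) ⊔ Ideal.span {linForm (φ 0)} := by
  obtain ⟨P, hP, i, hi, hne⟩ := hc.exists_line_form_ne_zero h2
  refine ⟨i, hi, fun hmem => hne ?_⟩
  obtain ⟨a, ⟨haI, haT⟩, b, hb, hab⟩ := Submodule.mem_sup.1 hmem
  obtain ⟨b, rfl⟩ := Ideal.mem_span_singleton.1 hb
  have hbT : b ∈ formIdeal φ (lineIdx n) := by
    refine mem_formIdeal_of_mul_mem φ (i := 0) (fun h => h.1 rfl) ?_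
    rw [← add_sub_cancel_left a (_ * b), hab]
    exact sub_mem (linForm_mem_formIdeal φ hi) haT
  have hb0 : constantCoeff b = 0 := by
    rw [← mem_formIdeal_univ_iff φ]
    exact formIdeal_mono φ (Set.subset_univ _) hbT
  have h1 := intComponent_of_isHomogeneous (isHomogeneous_linForm (φ i)) 1
  rw [← hab, map_add, intComponent_mul_left (isHomogeneous_linForm _), hab, if_pos (by simp),
    Nat.cast_one, sub_self, intComponent_zero, hb0, C_0, mul_zero, add_zero] at h1
  rw [← eval_linForm, ← h1]
  exact eval_rep_eq_zero_of_mem_idealOf (isGradedIdeal_idealOf _ _ haI _) P (Or.inl hP)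

/-- Interpolation in degree k yields g = ∑ φᵢsᵢ in T with φ₀g = f on Γ₁; both sides vanish on L, so
f - φ₀g ∈ I ∩ T. The two extra degrees are those of φ₀ and φᵢ. -/
lemma mem_sup_of_hilbertFunction_eq {k : ℕ}
    (hk : hilbertFunction (idealOf Γ₁) k = Γ₁.ncard) {f : MvPolynomial (Fin (n + 1)) K}
    (hf : f.IsHomogeneous (1 + (1 + k))) (hfT : f ∈ formIdeal φ (lineIdx n)) :
    f ∈ (idealOf (Γ₁ ∪ Γ₂) ⊓ formIdeal φ (lineIdx n)) ⊔ Ideal.span {linForm (φ 0)} := by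
  classical
  have hs : ∃ ι : ℙ K (Fin (n + 1) → K) → Fin (n + 1), ∀ P, (∃ i ∈ lineIdx n, φ i P.rep ≠ 0) →
      ι P ∈ lineIdx n ∧ φ (ι P) P.rep ≠ 0 := by
    refine ⟨fun P => if h : ∃ i ∈ lineIdx n, φ i P.rep ≠ 0 then h.choose else 0, fun P h => ?_⟩
    simp only [dif_pos h]
    exact h.choose_spec
  obtain ⟨ι, hι⟩ := hs
  -- `ι P` selects an equation of the line that is nonzero at `P`, so exactly one summand of `g`
  -- carries the value needed there.
  choose s hsh hs using fun i => exists_form_eval_eq hc.finite_left hk fun P =>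
    if i = ι P then eval P.rep f / (φ 0 P.rep * φ i P.rep) else 0
  let T : Finset (Fin (n + 1)) := Finset.univ.filter (· ∈ lineIdx n)
  have hT : ∀ i, i ∈ T ↔ i ∈ lineIdx n := by simp [T]
  let g := ∑ i ∈ T, linForm (φ i) * s i
  have hgh : g.IsHomogeneous (1 + k) :=
    IsHomogeneous.sum _ _ _ fun i _ => (isHomogeneous_linForm _).mul (hsh i)
  have hgT : g ∈ formIdeal φ (lineIdx n) := sum_mem fun i hi =>
    Ideal.mul_mem_right _ _ (linForm_mem_formIdeal φ ((hT i).1 hi))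
  have hfg : f - linForm (φ 0) * g ∈ formIdeal φ (lineIdx n) :=
    sub_mem hfT (Ideal.mul_mem_left _ _ hgT)
  rw [← sub_add_cancel f (linForm (φ 0) * g)]
  refine add_mem (Ideal.mem_sup_left ⟨?_, hfg⟩)
    (Ideal.mem_sup_right (Ideal.mul_mem_right _ _ (Ideal.mem_span_singleton_self _)))
  refine (mem_idealOf_iff_of_isHomogeneous (hf.sub ((isHomogeneous_linForm _).mul hgh))).2 ?_
  rintro P (hP | hP)
  · by_cases hex : ∃ i ∈ lineIdx n, φ i P.rep ≠ 0
    · obtain ⟨h1, h2⟩ := hι P hex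
      have h0 := hc.nonvanishing P (Or.inl hP)
      rw [map_sub, map_mul, eval_linForm, map_sum, Finset.sum_eq_single (ι P)]
      · rw [map_mul, eval_linForm, hs _ P hP, if_pos rfl]
        field_simp
        ring
      · intro i _ hi
        rw [map_mul, hs _ P hP, if_neg hi, mul_zero]
      · intro h
        exact absurd ((hT _).2 h1) h
    · push Not at hex
      exact eval_eq_zero_of_mem_formIdeal φ hfg hex
  · exact eval_eq_zero_of_mem_formIdeal φ hfg (hc.line P hP)

/-- If the points of `Γ₁` impose independent conditions on forms of degree `|Γ₂| - 2`, then there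
is a socle degree less than `|Γ₂|`. -/
lemma exists_socleDegree_lt [Infinite K] (h1 : 2 ≤ Γ₁.ncard) {k : ℕ}
    (hk2 : k + 2 = Γ₂.ncard) (hk : hilbertFunction (idealOf Γ₁) k = Γ₁.ncard) :
    ∃ c ∈ socleDegrees (Γ₁ ∪ Γ₂), c < Γ₂.ncard := by
  -- `S c` says that the image of T modulo (I ∩ T) + (φ₀) is zero in degree `c`; a degree where it
  -- fails just before it holds produces a socle element.
  let S : ℕ → Prop := fun c => ∀ f : MvPolynomial (Fin (n + 1)) K, f.IsHomogeneous c →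
    f ∈ formIdeal φ (lineIdx n) →
      f ∈ (idealOf (Γ₁ ∪ Γ₂) ⊓ formIdeal φ (lineIdx n)) ⊔ Ideal.span {linForm (φ 0)}
  have hS1 : ¬ S 1 := by
    obtain ⟨i, hi, hnot⟩ := hc.exists_linForm_notMem h1
    exact fun h => hnot (h _ (isHomogeneous_linForm _) (linForm_mem_formIdeal φ hi))
  have hSβ : S Γ₂.ncard := by
    intro f hf hfT
    rw [← hk2, show k + 2 = 1 + (1 + k) by ring] at hf
    exact hc.mem_sup_of_hilbertFunction_eq hk hf hfT
  obtain ⟨c, hcβ, hSc, hSc1⟩ : ∃ c < Γ₂.ncard, ¬ S c ∧ S (c + 1) := by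
    by_contra! hstep
    have : ∀ c, 1 ≤ c → c ≤ Γ₂.ncard → ¬ S c := by
      intro c hc1
      induction c, hc1 using Nat.le_induction with
      | base => exact fun _ => hS1
      | succ c _ ih => exact fun hle => hstep c hle (ih (by omega))
    exact this _ (by omega) le_rfl hSβ
  simp only [S] at hSc hSc1
  push Not at hSc
  obtain ⟨f, hf, hfT, hnot⟩ := hSc
  have hΓ : (Γ₁ ∪ Γ₂).Nonempty := by
    obtain ⟨P, hP⟩ := Set.nonempty_of_ncard_ne_zero (s := Γ₂) (by omega)
    exact ⟨P, Or.inr hP⟩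
  refine ⟨c, (mem_socleDegrees_iff_forms hΓ φ hc.nonvanishing).2
    ⟨c, rfl, f, hf, fun i => ?_, fun hmem => hnot ?_⟩, by exact_mod_cast hcβ⟩
  · have := hSc1 (linForm (φ i) * f)
      (by rw [add_comm c 1]; exact (isHomogeneous_linForm _).mul hf)
      (Ideal.mul_mem_left _ _ hfT)
    have hle : (idealOf (Γ₁ ∪ Γ₂) ⊓ formIdeal φ (lineIdx n)) ⊔ Ideal.span {linForm (φ 0)} ≤
        idealOf (Γ₁ ∪ Γ₂) ⊔ Ideal.span {linForm (φ 0)} := sup_le_sup_right inf_le_left _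
    exact hle this
  -- The degree c part of a vanishes on Γ₂ and c < β, so it already lies in T; this lets I be
  -- replaced by I ∩ T.
  · obtain ⟨a, ha, b, hb, hab⟩ := Submodule.mem_sup.1 hmem
    obtain ⟨b, rfl⟩ := Ideal.mem_span_singleton.1 hb
    have h2 := intComponent_of_isHomogeneous hf c
    rw [if_pos rfl, ← hab, map_add, intComponent_mul_left (isHomogeneous_linForm _), hab] at h2
    have h3 := isGradedIdeal_idealOf _ _ ha c
    rw [← h2]
    refine add_mem (Ideal.mem_sup_left ⟨h3, hc.mem_formIdeal_lineIdx hcβ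
      (isHomogeneous_intComponent _ _) fun P hP => ?_⟩)
      (Ideal.mem_sup_right (Ideal.mul_mem_right _ _ (Ideal.mem_span_singleton_self _)))
    exact eval_rep_eq_zero_of_mem_idealOf h3 P (Or.inr hP)

lemma exists_isLeast_socleDegrees_lt [Infinite K] (h1 : 2 ≤ Γ₁.ncard) {k : ℕ}
    (hk2 : k + 2 = Γ₂.ncard) (hk : hilbertFunction (idealOf Γ₁) k = Γ₁.ncard) :
    ∃ A : ℤ, IsLeast (socleDegrees (Γ₁ ∪ Γ₂)) A ∧ A < Γ₂.ncard := by
  obtain ⟨c, hcS, hcβ⟩ := hc.exists_socleDegree_lt h1 hk2 hk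
  have hΓ : (Γ₁ ∪ Γ₂).Nonempty := by
    obtain ⟨P, hP⟩ := Set.nonempty_of_ncard_ne_zero (s := Γ₂) (by omega)
    exact ⟨P, Or.inr hP⟩
  obtain ⟨A, hA, hle⟩ := Int.exists_least_of_bdd (P := (· ∈ socleDegrees (Γ₁ ∪ Γ₂)))
    ⟨0, fun z hz => by
      obtain ⟨m, rfl, -⟩ := (mem_socleDegrees_iff_forms hΓ φ hc.nonvanishing).1 hz
      exact Int.natCast_nonneg m⟩ ⟨c, hcS⟩
  exact ⟨A, ⟨hA, hle⟩, (hle c hcS).trans_lt hcβ⟩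

end Configuration

/-! ### General points of the hyperplane. -/

/-- Linearly independent functions have a nonzero evaluation determinant. -/
lemma exists_det_ne_zero_of_linearIndependent {X : Type*} {k : ℕ} {g : Fin k → X → K}
    (hg : LinearIndependent K g) : ∃ x : Fin k → X, (Matrix.of fun a b => g b (x a)).det ≠ 0 := by
  let v : X → Fin k → K := fun x b => g b x
  -- A functional killing all the vectors `v x` would be a linear relation between the functions.
  have hspan : Submodule.span K (Set.range v) = ⊤ := by
    by_contra hne
    obtain ⟨ψ, hψ, hle⟩ := Submodule.exists_le_ker_of_lt_top _ (lt_top_iff_ne_top.2 hne)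
    refine hψ ?_
    have h0 : ∀ b, ψ (Pi.single b 1) = 0 := by
      rw [Fintype.linearIndependent_iff] at hg
      refine hg _ ?_
      ext x
      have h1 : ψ (v x) = 0 := hle (Submodule.subset_span ⟨x, rfl⟩)
      rw [ψ.pi_apply_eq_sum_univ] at h1
      rw [Finset.sum_apply, Pi.zero_apply, ← h1]
      refine Finset.sum_congr rfl fun b _ => ?_
      rw [Pi.smul_apply, smul_eq_mul, smul_eq_mul, mul_comm]
      congr 2
      ext j
      simp [Pi.single_apply, eq_comm]
    ext b
    simpa using h0 b
  obtain ⟨κ, a, -, ha, hli⟩ := exists_linearIndependent' K v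
  have hb : Basis κ K (Fin k → K) := Basis.mk hli (by rw [ha, hspan])
  have := hli.finite
  have := Fintype.ofFinite κ
  have hcard : Fintype.card κ = Fintype.card (Fin k) := by
    rw [← finrank_eq_card_basis hb, finrank_fin_fun, Fintype.card_fin]
  let e := Fintype.equivOfCardEq hcard
  refine ⟨fun i => a (e.symm i), ?_⟩
  have hrows : LinearIndependent K (Matrix.of fun i b => g b (a (e.symm i))).row :=
    hli.comp _ e.symm.injective
  rw [Matrix.linearIndependent_rows_iff_isUnit, Matrix.isUnit_iff_isUnit_det] at hrows
  exact hrows.ne_zero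

/-- The property `p` holds for all tuples of vectors of `H` in a nonempty Zariski open set. -/
def HoldsGenerically (H : Submodule K (Fin (n + 1) → K)) (α : ℕ)
    (p : (Fin α → Fin (n + 1) → K) → Prop) : Prop :=
  ∃ F : MvPolynomial (Fin α × Fin (n + 1)) K,
    (∃ w : Fin α → Fin (n + 1) → K, (∀ j, w j ∈ H) ∧ eval (fun x => w x.1 x.2) F ≠ 0) ∧
    ∀ w : Fin α → Fin (n + 1) → K, (∀ j, w j ∈ H) → eval (fun x => w x.1 x.2) F ≠ 0 → p w

namespace HoldsGenerically

variable {H : Submodule K (Fin (n + 1) → K)} {α : ℕ}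

/-- Tuples of vectors of H form a linear space. On the line joining the two witnesses both
polynomials restrict to nonzero polynomials in one variable, so their product is nonzero at some
point of it. -/
lemma and [Infinite K] {p q : (Fin α → Fin (n + 1) → K) → Prop} (hp : HoldsGenerically H α p)
    (hq : HoldsGenerically H α q) : HoldsGenerically H α fun w => p w ∧ q w := by
  obtain ⟨F, ⟨u, huH, hu⟩, hF⟩ := hp
  obtain ⟨G, ⟨v, hvH, hv⟩, hG⟩ := hq
  let ρ : MvPolynomial (Fin α × Fin (n + 1)) K →ₐ[K] Polynomial K := aeval fun x =>
    Polynomial.C (u x.1 x.2) + Polynomial.C (v x.1 x.2 - u x.1 x.2) * Polynomial.X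
  have hρ : ∀ t P, (ρ P).eval t = eval (fun x => (u + t • (v - u)) x.1 x.2) P := by
    intro t P
    have h : (Polynomial.evalRingHom t).comp ρ.toRingHom =
        eval (fun x => (u + t • (v - u)) x.1 x.2) :=
      MvPolynomial.ringHom_ext (by simp [ρ])
        fun x => by simp [ρ, mul_comm t (v x.1 x.2 - u x.1 x.2)]
    exact congrArg (fun F => F P) h
  have hne : ρ F * ρ G ≠ 0 := by
    refine mul_ne_zero (fun h => hu ?_) (fun h => hv ?_)
    · have := hρ 0 F
      rw [h, Polynomial.eval_zero] at this
      simpa using this.symm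
    · have := hρ 1 G
      rw [h, Polynomial.eval_zero] at this
      simpa using this.symm
  obtain ⟨t, ht⟩ : ∃ t, (ρ F * ρ G).eval t ≠ 0 := by
    by_contra! h
    exact hne (Polynomial.funext fun t => by rw [h t, Polynomial.eval_zero])
  refine ⟨F * G, ⟨u + t • (v - u), fun j => ?_, ?_⟩, fun w hw hFG => ?_⟩
  · exact add_mem (huH j) (H.smul_mem t (sub_mem (hvH j) (huH j)))
  · rwa [Polynomial.eval_mul, hρ, hρ, ← map_mul] at ht
  · rw [map_mul] at hFG
    exact ⟨hF w hw (left_ne_zero_of_mul hFG), hG w hw (right_ne_zero_of_mul hFG)⟩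

lemma forall_finite [Infinite K] {ι : Type*} [Finite ι]
    {p : ι → (Fin α → Fin (n + 1) → K) → Prop} (hp : ∀ i, HoldsGenerically H α (p i)) :
    HoldsGenerically H α fun w => ∀ i, p i w := by
  classical
  have := Fintype.ofFinite ι
  have key : ∀ s : Finset ι, HoldsGenerically H α fun w => ∀ i ∈ s, p i w := by
    intro s
    induction s using Finset.induction_on with
    | empty => exact ⟨1, ⟨0, fun _ => H.zero_mem, by simp⟩, by simp⟩
    | insert i s _ ih => simpa using (hp i).and ih
  simpa using key Finset.univ

lemma det_ne_zero {k : ℕ} {f : Fin k → MvPolynomial (Fin (n + 1)) K}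
    (hf : LinearIndependent K fun b (w : H) => eval w.1 (f b)) {σ : Fin k → Fin α}
    (hσ : Function.Injective σ) :
    HoldsGenerically H α fun w => (Matrix.of fun a b => eval (w (σ a)) (f b)).det ≠ 0 := by
  obtain ⟨F, hF⟩ : ∃ F : MvPolynomial (Fin α × Fin (n + 1)) K, ∀ w : Fin α → Fin (n + 1) → K,
      eval (fun x => w x.1 x.2) F = (Matrix.of fun a b => eval (w (σ a)) (f b)).det := by
    refine ⟨(Matrix.of fun a b => rename (fun i => (σ a, i)) (f b)).det, fun w => ?_⟩
    rw [RingHom.map_det]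
    congr 1
    ext a b
    simp [eval_rename, Function.comp_def]
  obtain ⟨x, hx⟩ := exists_det_ne_zero_of_linearIndependent hf
  let u : Fin α → H := Function.extend σ x 0
  have hu : ∀ a, u (σ a) = x a := hσ.extend_apply x 0
  have hFu := hF fun j => (u j).1
  simp only [hu] at hFu
  exact ⟨F, ⟨fun j => (u j).1, fun j => (u j).2, fun h => hx (hFu.symm.trans h)⟩,
    fun w _ hw h => hw ((hF w).trans h)⟩

end HoldsGenerically

section IndependentForms

variable (φ : Basis (Fin (n + 1)) K (Dual K (Fin (n + 1) → K)))

lemma linearIndependent_linForm_on_hyperplane {H : Submodule K (Fin (n + 1) → K)}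
    (hH : ∀ w, w ∈ H ↔ φ 1 w = 0) {k : ℕ} {s : Fin k → Fin (n + 1)}
    (hs : Function.Injective s) (hs1 : ∀ b, s b ≠ 1) :
    LinearIndependent K fun b (w : H) => eval w.1 (linForm (φ (s b))) := by
  rw [Fintype.linearIndependent_iff]
  intro c hc b
  obtain ⟨w, hw⟩ := exists_forall_apply_eq φ (Pi.single (s b) 1)
  have hwH : w ∈ H := (hH w).2 (by rw [hw, Pi.single_eq_of_ne (hs1 b).symm])
  have h := congrFun hc ⟨w, hwH⟩
  simpa [eval_linForm, hw, Pi.single_apply, hs.eq_iff] using h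

/-- The kernel of restriction to H consists of the multiples of φ₁, so its image has dimension C(i +
n - 1, n - 1). -/
lemma exists_linearIndependent_forms_on_hyperplane [Infinite K] (hn : 1 ≤ n)
    {H : Submodule K (Fin (n + 1) → K)} (hH : ∀ w, w ∈ H ↔ φ 1 w = 0) {i k : ℕ}
    (hk : k ≤ (i + (n - 1)).choose (n - 1)) :
    ∃ f : Fin k → MvPolynomial (Fin (n + 1)) K, (∀ b, (f b).IsHomogeneous i) ∧
      LinearIndependent K fun b (w : H) => eval w.1 (f b) := by
  let E : Forms K n i →ₗ[K] (H → K) :=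
    { toFun := fun f w => eval w.1 f.1
      map_add' := fun f g => by ext w; simp
      map_smul' := fun c f => by ext w; simp [smul_eval] }
  have hker : LinearMap.ker E = divisibleForms φ 1 i := by
    ext f
    rw [LinearMap.mem_ker, mem_divisibleForms]
    constructor
    · intro h
      exact mem_formIdeal_of_forall_eval_eq_zero φ fun w hw =>
        congrFun h ⟨w, (hH w).2 (hw 1 rfl)⟩
    · intro h
      ext w
      refine eval_eq_zero_of_mem_formIdeal φ h fun j hj => ?_
      rw [show j = 1 from hj]
      exact (hH _).1 w.2
  have h1 := LinearMap.finrank_range_add_finrank_ker E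
  have h2 := finrank_divisibleForms φ hn 1 i
  rw [hker, finrank_forms] at h1
  obtain ⟨g, hg⟩ := exists_linearIndependent_of_le_finrank (R := K)
    (M := LinearMap.range E) (n := k) (by omega)
  choose f hf using fun b => (g b).2
  refine ⟨fun b => (f b).1, fun b => (f b).2, ?_⟩
  have : (fun b (w : H) => eval w.1 (f b).1) = fun b => (g b).1 := _root_.funext fun b => hf b
  rw [this]
  exact hg.map' (LinearMap.range E).subtype (Submodule.ker_subtype _)

/-- A nonzero combination of forms vanishes at less than `k` of the vectors if all evaluation
determinants are nonzero. -/
lemma card_filter_lt_of_det_ne_zero {α k : ℕ} {w : Fin α → Fin (n + 1) → K}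
    {ψ : Fin k → Dual K (Fin (n + 1) → K)}
    (hdet : ∀ σ : Fin k ↪ Fin α, (Matrix.of fun a b => eval (w (σ a)) (linForm (ψ b))).det ≠ 0)
    {c : Fin k → K} (hc : c ≠ 0) {J : Finset (Fin α)}
    (hJ : ∀ j ∈ J, ∑ b, c b * ψ b (w j) = 0) : J.card < k := by
  by_contra! hle
  let σ := (J.orderEmbOfCardLe hle).toEmbedding
  refine hc (Matrix.eq_zero_of_mulVec_eq_zero (hdet σ) ?_)
  ext a
  rw [Pi.zero_apply, ← hJ (σ a) (J.orderEmbOfCardLe_mem hle a)]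
  simp only [Matrix.mulVec, dotProduct, Matrix.of_apply, eval_linForm]
  exact Finset.sum_congr rfl fun b _ => mul_comm _ _

end IndependentForms

/-- Multiplication by a linear form vanishing at no point of Γ carries interpolation to the next
degree. -/
lemma hilbertFunction_eq_ncard_succ [Infinite K] {Γ : Set (ℙ K (Fin (n + 1) → K))}
    (hΓ : Γ.Finite) {i : ℕ} (h : hilbertFunction (idealOf Γ) i = Γ.ncard) :
    hilbertFunction (idealOf Γ) (i + 1) = Γ.ncard := by
  classical
  have := hΓ.fintype
  obtain ⟨l, hl⟩ := exists_dual_forall_apply_ne_zero (K := K) (fun P : Γ => P.1.rep)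
    fun P => P.1.rep_nonzero
  rw [hilbertFunction_eq_finrank_range, LinearMap.range_eq_top.2, finrank_top, finrank_pi,
    ← Nat.card_coe_set_eq, Nat.card_eq_fintype_card]
  intro g
  obtain ⟨f, hf, hfg⟩ := exists_form_eval_eq hΓ h
    fun P => if hP : P ∈ Γ then g ⟨P, hP⟩ / l P.rep else 0
  refine ⟨⟨linForm l * f, ?_⟩, ?_⟩
  · have := (isHomogeneous_linForm l).mul hf
    rwa [add_comm 1 i] at this
  · ext P
    change eval P.1.rep (linForm l * f) = g P
    rw [map_mul, eval_linForm, hfg P.1 P.2, dif_pos P.2, mul_div_cancel₀ _ (hl P)]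

/-- The maximal Hilbert function thus reaches α by degree α, so genericity is a condition on the
finitely many degrees i ≤ α. -/
lemma le_choose_add (hn : 2 ≤ n) (α : ℕ) : α ≤ (α + (n - 1)).choose (n - 1) := by
  rw [← Nat.choose_symm_add]
  have h1 := Nat.choose_le_choose α (show α + 1 ≤ α + (n - 1) by omega)
  rw [Nat.choose_succ_self_right] at h1
  omega

/-- The points of a tuple of nonzero vectors of the hyperplane with nonzero evaluation determinants
are distinct and generic. -/
lemma ncard_range_mk_and_isGenericSet [Infinite K] (hn : 2 ≤ n)
    (φ : Basis (Fin (n + 1)) K (Dual K (Fin (n + 1) → K))) {α : ℕ}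
    {w : Fin α → Fin (n + 1) → K} (hw : ∀ j, φ 1 (w j) = 0) (h0 : ∀ j, w j ≠ 0)
    (hdet : ∀ i ≤ α, ∃ (σ : Fin (min ((i + (n - 1)).choose (n - 1)) α) → Fin α)
      (f : Fin (min ((i + (n - 1)).choose (n - 1)) α) → MvPolynomial (Fin (n + 1)) K),
      (∀ b, (f b).IsHomogeneous i) ∧ (Matrix.of fun a b => eval (w (σ a)) (f b)).det ≠ 0) :
    (Set.range fun j => Projectivization.mk K (w j) (h0 j)).ncard = α ∧
      IsGenericSet (n - 1) (Set.range fun j => Projectivization.mk K (w j) (h0 j)) := by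
  set Γ := Set.range fun j => Projectivization.mk K (w j) (h0 j) with hΓdef
  have hΓ : Γ.Finite := Set.finite_range _
  have hrep : ∀ j, ∃ c : K, c • w j = (Projectivization.mk K (w j) (h0 j)).rep := fun j => by
    obtain ⟨a, ha⟩ := Projectivization.exists_smul_eq_mk_rep K (w j) (h0 j)
    exact ⟨a, ha⟩
  have hrep' : ∀ j, ∃ P ∈ Γ, ∃ c : K, w j = c • P.rep := fun j => by
    obtain ⟨a, ha⟩ := Projectivization.exists_smul_eq_mk_rep K (w j) (h0 j)
    refine ⟨_, ⟨j, rfl⟩, (a⁻¹ : Kˣ), ?_⟩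
    rw [← ha]
    exact (inv_smul_smul a (w j)).symm
  have hH : ∀ P ∈ Γ, φ 1 P.rep = 0 := by
    rintro _ ⟨j, rfl⟩
    obtain ⟨c, hc⟩ := hrep j
    rw [← hc, map_smul, hw, smul_zero]
  have hlow : ∀ i ≤ α,
      min ((i + (n - 1)).choose (n - 1)) α ≤ hilbertFunction (idealOf Γ) i := by
    intro i hi
    obtain ⟨σ, f, hf, hd⟩ := hdet i hi
    exact le_hilbertFunction_of_det_ne_zero hf (fun a => hrep' (σ a)) hd
  have hle : Γ.ncard ≤ α := by
    rw [hΓdef, ← Set.image_univ]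
    refine (Set.ncard_image_le Set.finite_univ).trans ?_
    simp
  -- Degree α already gives Hilbert function at least α, which forces the α points to be distinct.
  have hα := hlow α le_rfl
  rw [min_eq_right (le_choose_add hn α)] at hα
  have hup := fun i => hilbertFunction_le_ncard hΓ i
  have hcard : Γ.ncard = α := le_antisymm hle (hα.trans (hup α))
  refine ⟨hcard, fun i => ?_⟩
  rw [hcard]
  refine le_antisymm (le_min (hilbertFunction_le_choose (by omega) hH i) (hcard ▸ hup i)) ?_
  rcases le_or_gt i α with hi | hi
  · exact hlow i hi
  · refine (min_le_right _ _).trans ?_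
    have key : ∀ i, α ≤ i → hilbertFunction (idealOf Γ) i = Γ.ncard := by
      intro i hi
      induction i, hi using Nat.le_induction with
      | base => exact le_antisymm (hup α) (hle.trans hα)
      | succ i _ ih => exact hilbertFunction_eq_ncard_succ hΓ ih
    rw [key i hi.le, hcard]

/-- A hyperplane not containing the line contains at most one of the points on it. -/
lemma ncard_line_inter_hyperplane_le_one {L : Submodule K (Fin (n + 1) → K)}
    (hL : finrank K L = 2) {Γ : Set (ℙ K (Fin (n + 1) → K))} (hfin : Γ.Finite)
    (hΓ : ∀ P ∈ Γ, P.rep ∈ L) {h : Dual K (Fin (n + 1) → K)} (hne : ∃ v ∈ L, h v ≠ 0) :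
    {P | P ∈ Γ ∧ h P.rep = 0}.ncard ≤ 1 := by
  rw [Set.ncard_le_one (hfin.subset fun P hP => hP.1)]
  rintro P ⟨hP, hPh⟩ Q ⟨hQ, hQh⟩
  obtain ⟨v, hv, hv0⟩ := hne
  have h0 : h.domRestrict L ≠ 0 := fun h0 => hv0 (LinearMap.congr_fun h0 ⟨v, hv⟩)
  have h1 := Dual.finrank_ker_add_one_of_ne_zero h0
  have h2 : finrank K (LinearMap.ker (h.domRestrict L)) = 1 := by omega
  have hQ0 : (⟨⟨Q.rep, hΓ Q hQ⟩, hQh⟩ : LinearMap.ker (h.domRestrict L)) ≠ 0 := fun h0 =>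
    Q.rep_nonzero (congrArg (fun x => x.1.1) h0)
  obtain ⟨c, hc⟩ := (finrank_eq_one_iff_of_nonzero' (K := K)
    (V := LinearMap.ker (h.domRestrict L)) _ hQ0).1 h2 ⟨⟨P.rep, hΓ P hP⟩, hPh⟩
  exact eq_of_rep_eq_smul (c := c) (congrArg (fun x => x.1.1) hc).symm

/-- If the vectors `w j` of the hyperplane are in general position, also with respect to the
intersection point of the hyperplane and the line, then no hyperplane contains more than `α`
points. -/
lemma hyp_range_union_le {m : ℕ}
    {φ : Basis (Fin (m + 1 + 1)) K (Dual K (Fin (m + 1 + 1) → K))}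
    {L : Submodule K (Fin (m + 1 + 1) → K)} (hL : finrank K L = 2)
    (hLφ : ∀ w, w ∈ L ↔ ∀ i, i ≠ 0 → i ≠ 1 → φ i w = 0)
    {Γ₂ : Set (ℙ K (Fin (m + 1 + 1) → K))} (hfin : Γ₂.Finite) (hΓL : ∀ P ∈ Γ₂, P.rep ∈ L)
    (hΓH : ∀ P ∈ Γ₂, φ 1 P.rep ≠ 0) {α : ℕ} (hα : m + 1 ≤ α) (hβ : Γ₂.ncard + m ≤ α + 1)
    {w : Fin α → Fin (m + 1 + 1) → K} (hw : ∀ j, φ 1 (w j) = 0) (h0 : ∀ j, w j ≠ 0)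
    (hdet₁ : ∀ σ : Fin (m + 1) ↪ Fin α, (Matrix.of fun a b =>
      eval (w (σ a)) (linForm (φ ((1 : Fin (m + 1 + 1)).succAbove b)))).det ≠ 0)
    (hdet₂ : ∀ σ : Fin m ↪ Fin α, (Matrix.of fun a b =>
      eval (w (σ a)) (linForm (φ b.succ.succ))).det ≠ 0) :
    hyp ((Set.range fun j => Projectivization.mk K (w j) (h0 j)) ∪ Γ₂) ≤ α := by
  classical
  refine hyp_le fun H' hH' => ?_
  obtain ⟨h', hh'⟩ := exists_dual_mem_iff_apply_eq_zero hH'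
  simp only [submodule_le_iff_rep_mem, hh']
  let J : Finset (Fin α) := Finset.univ.filter fun j => h' (w j) = 0
  have hJ : ∀ j ∈ J, h' (w j) = 0 := fun j hj => (Finset.mem_filter.1 hj).2
  have hJα : J.card ≤ α := by simpa using Finset.card_le_univ J
  have hcover : {P | P ∈ (Set.range fun j => Projectivization.mk K (w j) (h0 j)) ∪ Γ₂ ∧
      h' P.rep = 0} ⊆ (fun j => Projectivization.mk K (w j) (h0 j)) '' J ∪
        {P | P ∈ Γ₂ ∧ h' P.rep = 0} := by
    rintro _ ⟨⟨j, rfl⟩ | hP, hP0⟩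
    · refine Or.inl ⟨j, Finset.mem_coe.2 (Finset.mem_filter.2 ⟨Finset.mem_univ _, ?_⟩), rfl⟩
      obtain ⟨a, ha⟩ := Projectivization.exists_smul_eq_mk_rep K (w j) (h0 j)
      rw [← ha, Units.smul_def, map_smul, smul_eq_mul] at hP0
      exact (mul_eq_zero.1 hP0).resolve_left a.ne_zero
    · exact Or.inr ⟨hP, hP0⟩
  have hfinr : {P | P ∈ Γ₂ ∧ h' P.rep = 0}.Finite := hfin.subset fun P hP => hP.1
  have hcard := (Set.ncard_le_ncard hcover ((J.finite_toSet.image _).union hfinr)).trans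
    (Set.ncard_union_le _ _)
  have himage : ((fun j => Projectivization.mk K (w j) (h0 j)) '' (J : Set (Fin α))).ncard ≤
      J.card := by
    simpa using Set.ncard_image_le (f := fun j => Projectivization.mk K (w j) (h0 j))
      J.finite_toSet
  set c := fun b => φ.repr h' b with hc
  have hsum : ∀ v, h' v = ∑ b, c b * φ b v := by
    intro v
    conv_lhs => rw [← φ.sum_repr h', LinearMap.sum_apply]
    rfl
  have hne : h' ≠ 0 := by
    intro h
    have htop : H' = ⊤ := eq_top_iff.2 fun v _ => (hh' v).2 (by rw [h, LinearMap.zero_apply])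
    rw [htop, finrank_top, finrank_fin_fun] at hH'
    omega
  -- In this case the hyperplane is φ₁ = 0 itself and misses Γ₂.
  by_cases hA : ∀ b, b ≠ 1 → c b = 0
  · have hempty : {P | P ∈ Γ₂ ∧ h' P.rep = 0} = ∅ := by
      rw [Set.eq_empty_iff_forall_notMem]
      rintro P ⟨hP, hP0⟩
      have h1 : ∀ v, h' v = c 1 * φ 1 v := fun v => by
        rw [hsum, Finset.sum_eq_single 1 (fun b _ hb => by rw [hA b hb, zero_mul]) (by simp)]
      rw [h1] at hP0
      refine hne (LinearMap.ext fun v => ?_)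
      rw [h1, (mul_eq_zero.1 hP0).resolve_right (hΓH P hP), zero_mul, LinearMap.zero_apply]
    rw [hempty, Set.ncard_empty] at hcard
    omega
  push Not at hA
  obtain ⟨b, hb1, hb⟩ := hA
  have hcard₁ : J.card < m + 1 := by
    refine card_filter_lt_of_det_ne_zero hdet₁ (c := fun b => c ((1 : Fin _).succAbove b)) ?_ ?_
    · intro hzero
      obtain ⟨b', rfl⟩ := Fin.exists_succAbove_eq hb1
      exact hb (congrFun hzero b')
    · intro j hj
      rw [← hJ j hj, hsum (w j), Fin.sum_univ_succAbove (fun b => c b * φ b (w j)) 1, hw,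
        mul_zero, zero_add]
  -- In this case the hyperplane contains L. It then has at most m - 1 of the general points, by
  -- general position after projection from H ∩ L, and at most β ≤ α + 1 - m points of Γ₂.
  by_cases hB : c 0 = 0 ∧ c 1 = 0
  · have hcard₂ : J.card < m := by
      refine card_filter_lt_of_det_ne_zero hdet₂ (c := fun b => c b.succ.succ) ?_ ?_
      · intro hzero
        have hb0 : b ≠ 0 := fun h => hb (h ▸ hB.1)
        obtain ⟨b', rfl⟩ := Fin.exists_succ_eq.2 hb0
        have hb' : b' ≠ 0 := fun h => hb1 (by rw [h, Fin.succ_zero_eq_one])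
        obtain ⟨b'', rfl⟩ := Fin.exists_succ_eq.2 hb'
        exact hb (congrFun hzero b'')
      · intro j hj
        rw [← hJ j hj, hsum, Fin.sum_univ_succ, Fin.sum_univ_succ, Fin.succ_zero_eq_one, hB.1,
          hB.2]
        simp
    have := Set.ncard_le_ncard (fun P hP => hP.1 : {P | P ∈ Γ₂ ∧ h' P.rep = 0} ⊆ Γ₂) hfin
    omega
  -- Otherwise there are at most m general points and one point of Γ₂, and m + 1 ≤ α.
  · have hdual : ∀ b, ∃ v, (∀ i, i ≠ b → φ i v = 0) ∧ h' v = c b := by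
      intro b
      obtain ⟨v, hv⟩ := exists_forall_apply_eq φ (Pi.single b 1)
      refine ⟨v, fun i hi => by rw [hv, Pi.single_eq_of_ne hi], ?_⟩
      rw [hsum]
      simp [hv, Pi.single_apply]
    have hex : ∃ v ∈ L, h' v ≠ 0 := by
      rcases not_and_or.1 hB with h | h
      · obtain ⟨v, hv, hv'⟩ := hdual 0
        exact ⟨v, (hLφ v).2 fun i hi _ => hv i hi, hv' ▸ h⟩
      · obtain ⟨v, hv, hv'⟩ := hdual 1
        exact ⟨v, (hLφ v).2 fun i _ hi => hv i hi, hv' ▸ h⟩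
    have := ncard_line_inter_hyperplane_le_one hL hfin hΓL hex
    omega

/-- General points of a hyperplane are generic, and no hyperplane contains more of them together
with given points on a line. -/
lemma forGeneralPoints_generic [Infinite K] (hn : 2 ≤ n) {α : ℕ}
    {H L : Submodule K (Fin (n + 1) → K)} (hH : finrank K H = n) (hL : finrank K L = 2)
    (hLH : ¬ L ≤ H) {Γ₂ : Set (ℙ K (Fin (n + 1) → K))} (hfin : Γ₂.Finite)
    (hΓL : ∀ P ∈ Γ₂, P.submodule ≤ L) (hΓH : ∀ P ∈ Γ₂, ¬ P.submodule ≤ H)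
    (hα : n ≤ α) (hβ : Γ₂.ncard + n ≤ α + 2) :
    ForGeneralPoints H α fun Γ₁ =>
      Γ₁.ncard = α ∧ IsGenericSet (n - 1) Γ₁ ∧ hyp (Γ₁ ∪ Γ₂) = α := by
  obtain ⟨m, rfl⟩ : ∃ m, n = m + 1 := ⟨n - 1, by omega⟩
  obtain ⟨φ, hφH, hφL, -⟩ := exists_adapted_basis (by omega) hH hL hLH hfin
  have h10 : (0 : Fin (m + 1 + 1)) ≠ 1 := Fin.zero_ne_one
  -- `HoldsGenerically` admits zero vectors; φ₀ ≠ 0, written as a determinant of size one, supplies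
  -- nonzero vectors for the witness of `ForGeneralPoints`.
  have hne : HoldsGenerically H α fun w => ∀ j : Fin α, (Matrix.of fun (_ _ : Fin 1) =>
      eval (w j) (linForm (φ 0))).det ≠ 0 :=
    .forall_finite fun j => .det_ne_zero (linearIndependent_linForm_on_hyperplane φ hφH
      (s := fun _ => 0) (Function.injective_of_subsingleton _) fun _ => h10)
      (σ := fun _ => j) (Function.injective_of_subsingleton _)
  have hdet₁ : HoldsGenerically H α fun w => ∀ σ : Fin (m + 1) ↪ Fin α, (Matrix.of fun a b =>
      eval (w (σ a)) (linForm (φ ((1 : Fin (m + 1 + 1)).succAbove b)))).det ≠ 0 :=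
    .forall_finite fun σ => .det_ne_zero (linearIndependent_linForm_on_hyperplane φ hφH
      Fin.succAbove_right_injective fun b => Fin.succAbove_ne _ b) σ.injective
  have hdet₂ : HoldsGenerically H α fun w => ∀ σ : Fin m ↪ Fin α, (Matrix.of fun a b =>
      eval (w (σ a)) (linForm (φ b.succ.succ))).det ≠ 0 :=
    .forall_finite fun σ => .det_ne_zero (linearIndependent_linForm_on_hyperplane φ hφH
      (s := fun b => b.succ.succ) ((Fin.succ_injective _).comp (Fin.succ_injective _))
      fun b h => Fin.succ_ne_zero b (Fin.succ_injective _ h)) σ.injective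
  choose f hf hfli using fun i : Fin (α + 1) =>
    exists_linearIndependent_forms_on_hyperplane φ (by omega) hφH
      (i := i) (min_le_left ((i + (m + 1 - 1)).choose (m + 1 - 1)) α)
  have hdet₃ : HoldsGenerically H α fun w => ∀ i : Fin (α + 1), (Matrix.of fun a b =>
      eval (w (Fin.castLE (min_le_right _ _) a)) (f i b)).det ≠ 0 :=
    .forall_finite fun i => .det_ne_zero (hfli i) (Fin.castLE_injective _)
  obtain ⟨F, ⟨w, hwH, hwF⟩, hF⟩ := (hne.and hdet₁).and (hdet₂.and hdet₃)
  have hnz : ∀ w : Fin α → Fin (m + 1 + 1) → K, (∀ j : Fin α, (Matrix.of fun (_ _ : Fin 1) =>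
      eval (w j) (linForm (φ 0))).det ≠ 0) → ∀ j, w j ≠ 0 := by
    intro w hw j h
    refine hw j ?_
    rw [Matrix.det_fin_one, Matrix.of_apply, eval_linForm, h, map_zero]
  refine ⟨F, ⟨w, fun j => ⟨hwH j, hnz w (hF w hwH hwF).1.1 j⟩, hwF⟩, fun w hwH h0 hwF => ?_⟩
  obtain ⟨⟨-, h1⟩, h2, h3⟩ := hF w hwH hwF
  have hw : ∀ j, φ 1 (w j) = 0 := fun j => (hφH _).1 (hwH j)
  obtain ⟨hcard, hgen⟩ := ncard_range_mk_and_isGenericSet hn φ hw h0 fun i hi =>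
    ⟨_, f ⟨i, by omega⟩, hf ⟨i, by omega⟩, h3 ⟨i, by omega⟩⟩
  refine ⟨hcard, hgen, le_antisymm (hyp_range_union_le hL hφL hfin
    (fun P hP => submodule_le_iff_rep_mem.1 (hΓL P hP))
    (fun P hP h => hΓH P hP (submodule_le_iff_rep_mem.2 ((hφH _).2 h)))
    (by omega) (by omega) hw h0 h1 h2) ?_⟩
  have hfin₁ := Set.finite_range fun j => Projectivization.mk K (w j) (h0 j)
  refine le_trans hcard.ge (le_trans ?_ (le_hyp (hfin₁.union hfin) hH))
  refine Set.ncard_le_ncard ?_ ((hfin₁.union hfin).subset fun P hP => hP.1)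
  rintro _ ⟨j, rfl⟩
  refine ⟨Or.inl ⟨j, rfl⟩, ?_⟩
  rw [Projectivization.submodule_mk, Submodule.span_singleton_le_iff_mem]
  exact hwH j

end PointSets

end

theorem theorem3p6 {K : Type*} [Field K] [CharZero K] {n : ℕ} (hn : 2 ≤ n)
    {α β : ℕ} (hβ : 1 ≤ β) (hαβ : β + n - 2 ≤ α)
    (H L : Submodule K (Fin (n + 1) → K))
    (hH : Module.finrank K H = n) (hL : Module.finrank K L = 2) (hLH : ¬ L ≤ H)
    (Γ₂ : Set (ℙ K (Fin (n + 1) → K))) (hfin₂ : Γ₂.Finite) (hcard₂ : Γ₂.ncard = β)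
    (hΓ₂L : ∀ P ∈ Γ₂, P.submodule ≤ L) (hΓ₂H : ∀ P ∈ Γ₂, ¬ P.submodule ≤ H) :
    (∀ Γ₁ : Set (ℙ K (Fin (n + 1) → K)), Γ₁.Finite → Γ₁.ncard = α →
      (∀ P ∈ Γ₁, P.submodule ≤ H) → PointSets.IsGenericSet (n - 1) Γ₁ →
        (α < (β + n - 3).choose (n - 1) → PointSets.hyp (Γ₁ ∪ Γ₂) = α →
          ∃ A : ℤ, IsLeast (PointSets.socleDegrees (Γ₁ ∪ Γ₂)) A ∧
            A < (PointSets.minDist (Γ₁ ∪ Γ₂) : ℤ)) ∧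
        ((β + n).choose (n - 1) ≤ α →
          IsLeast (PointSets.socleDegrees (Γ₁ ∪ Γ₂)) (PointSets.minDist (Γ₁ ∪ Γ₂) : ℤ))) ∧
    (n ≤ α → PointSets.ForGeneralPoints H α fun Γ₁ =>
      Γ₁.ncard = α ∧ PointSets.IsGenericSet (n - 1) Γ₁ ∧
        PointSets.hyp (Γ₁ ∪ Γ₂) = α) := by
  subst hcard₂
  refine ⟨fun Γ₁ hfin₁ hcard₁ hΓ₁ hgen => ?_, fun hα =>
    PointSets.forGeneralPoints_generic hn hH hL hLH hfin₂ hΓ₂L hΓ₂H hα (by omega)⟩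
  obtain ⟨φ, hφH, hφL, hφ0⟩ :=
    PointSets.exists_adapted_basis (by omega) hH hL hLH (hfin₁.union hfin₂)
  subst hcard₁
  have hc : PointSets.Configuration φ Γ₁ Γ₂ :=
    { two_le := hn
      finite_left := hfin₁
      finite_right := hfin₂
      hyperplane := fun P hP => (hφH _).1 (PointSets.submodule_le_iff_rep_mem.1 (hΓ₁ P hP))
      line := fun P hP i hi =>
        (hφL _).1 (PointSets.submodule_le_iff_rep_mem.1 (hΓ₂L P hP)) i hi.1 hi.2
      off_hyperplane := fun P hP h =>
        hΓ₂H P hP (PointSets.submodule_le_iff_rep_mem.2 ((hφH _).2 h))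
      nonvanishing := hφ0 }
  constructor
  · intro hlt hhyp
    rw [hc.minDist_eq hhyp]
    -- The strict inequality forces the binomial coefficient to be nonzero, hence β ≥ 2 and then α ≥
    -- β + n - 2 ≥ 2.
    have hle : n - 1 ≤ Γ₂.ncard + n - 3 := by
      by_contra h
      rw [Nat.choose_eq_zero_of_lt (by omega)] at hlt
      omega
    have h2 : 2 ≤ Γ₁.ncard := by omega
    refine hc.exists_isLeast_socleDegrees_lt h2 (k := Γ₂.ncard - 2) (by omega) ?_
    -- In degree β - 2 the hyperplane has C(β + n - 3, n - 1) > α forms, so generic points impose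
    -- independent conditions.
    rw [hgen, min_eq_right]
    rw [show Γ₂.ncard - 2 + (n - 1) = Γ₂.ncard + n - 3 by omega]
    exact hlt.le
  · intro hge
    -- The weaker bound α ≥ C(β + n - 1, n - 1) suffices here.
    exact hc.isLeast_socleDegrees hβ hgen
      ((Nat.choose_le_choose _ (by omega)).trans hge)
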